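/- Let $n\ge 1$ and let $(M,\omega)$ be an $n$-plectic manifold: $M$ is a smooth finite-dimensional manifold and $\omega$ is a closed smooth $(n+1)$-form on $M$ such that $T_xM\to\Lambda^nT_x^*M$, $v\mapsto v\lrcorner\,\omega$, is injective for every $x\in M$. For a decomposable multivector field the contraction is $(X_1\wedge\dots\wedge X_k)\lrcorner\,\tau=\tau(X_1,\dots,X_k,\cdot,\dots,\cdot)$, extended linearly; it is $0$ when $k>\deg\tau$, and forms of negative degree are $0$. For $k\ge1$ let $\Omega^{n-k}_{\mathrm{Ham}}(M)$ be the space of Hamiltonian $(n-k)$-forms, i.e. the smooth $(n-k)$-forms $\alpha$ for which there is a smooth $k$-vector field $X_\alpha\in\Gamma(\Lambda^kTM)$ (a Hamiltonian multivector field of $\alpha$) with $d\alpha=-X_\alpha\lrcorner\,\omega$; put $|\alpha|=k+1$. For $\alpha\in\Omega^{n-k}_{\mathrm{Ham}}(M)$ and $\beta\in\Omega^{n-l}_{\mathrm{Ham}}(M)$ put $$\{\alpha,\beta\}=(-1)^{|\beta|}X_\beta\lrcorner X_\alpha\lrcorner\,\omega .$$ Let $k,l,m\ge1$, $\alpha\in\Omega^{n-k}_{\mathrm{Ham}}(M)$,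 $\beta\in\Omega^{n-l}_{\mathrm{Ham}}(M)$, $\gamma\in\Omega^{n-m}_{\mathrm{Ham}}(M)$. Then: 1. $\{\alpha,\beta\}$ does not depend on the choice of the Hamiltonian multivector fields $X_\alpha,X_\beta$, and $\{\alpha,\beta\}\in\Omega^{n-(k+l-1)}_{\mathrm{Ham}}(M)$, so that $|\{\alpha,\beta\}|=|\alpha|+|\beta|-2$. 2. (Graded skew-symmetry) $\{\alpha,\beta\}=-(-1)^{|\alpha||\beta|}\{\beta,\alpha\}$. 3. (Graded Jacobi identity up to an exact term) For arbitrary Hamiltonian multivector fields $X_\alpha,X_\beta,X_\gamma$ of $\alpha,\beta,\gamma$, $$(-1)^{|\alpha||\gamma|}\{\alpha,\{\beta,\gamma\}\}+(-1)^{|\beta||\alpha|}\{\beta,\{\gamma,\alpha\}\}+(-1)^{|\gamma||\beta|}\{\gamma,\{\alpha,\beta\}\}=(-1)^{|\beta||\gamma|+|\beta||\alpha|+|\beta|}\,d\left(X_\alpha\lrcorner X_\beta\lrcorner X_\gamma\lrcorner\,\omega\right).$$ 4. The bracket descends to a well-defined bilinear bracket on $\widetilde\Omega_{\mathrm{Ham}}(M)=\bigoplus_{k=1}^{n}\Omega^{n-k}_{\mathrm{Ham}}(M)/\{\text{closed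 forms}\}$ which makes it a graded Lie algebra. Here the bracket has degree $-2$ with respect to $|\cdot|$; equivalently, if the class of $\alpha$ is given the degree $|\alpha|-2=k-1$, which changes no sign, the bracket maps $L_i\times L_j$ to $L_{i+j}$, is graded skew-symmetric, and satisfies the graded Jacobi identity. -/

import Mathlib

open scoped Manifold

noncomputable section

namespace Multisymplectic

/-! ### Contraction of an alternating form by a multivector -/

section Algebra

theorem append_update_left {V : Type*} {k p : ℕ} [DecidableEq (Fin k)] (w : Fin k → V) (v : Fin p → V)
    (i : Fin k) (a : V) :
    Fin.append (Function.update w i a) v =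
      Function.update (Fin.append w v) (Fin.castAdd p i) a := by
  funext j
  refine Fin.addCases (fun j => ?_) (fun j => ?_) j
  · by_cases h : j = i
    · subst h; simp
    · have h' : Fin.castAdd p j ≠ Fin.castAdd p i := fun e => h (Fin.castAdd_injective k p e)
      simp [Function.update_of_ne h, Function.update_of_ne h']
  · have h' : Fin.natAdd k j ≠ Fin.castAdd p i := by
      intro e
      have := congrArg Fin.val e
      simp at this
      omega
    simp [Function.update_of_ne h']

theorem append_update_right {V : Type*} {k p : ℕ} [DecidableEq (Fin p)] (w : Fin k → V) (v : Fin p → V)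
    (i : Fin p) (a : V) :
    Fin.append w (Function.update v i a) =
      Function.update (Fin.append w v) (Fin.natAdd k i) a := by
  funext j
  refine Fin.addCases (fun j => ?_) (fun j => ?_) j
  · have h' : Fin.castAdd p j ≠ Fin.natAdd k i := by
      intro e
      have := congrArg Fin.val e
      simp at this
      omega
    simp [Function.update_of_ne h']
  · by_cases h : j = i
    · subst h; simp
    · have h' : Fin.natAdd k j ≠ Fin.natAdd k i := fun e => h (Fin.natAdd_injective p k e)
      simp [Function.update_of_ne h, Function.update_of_ne h']

variable {V : Type*} [AddCommGroup V] [Module ℝ V] [TopologicalSpace V]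

/-- `v ↦ τ (w₁, …, w_k, v₁, …, v_p)` as an alternating `p`-form. -/
def insertFirst {k p : ℕ} (τ : V [⋀^Fin (k + p)]→L[ℝ] ℝ) (w : Fin k → V) :
    V [⋀^Fin p]→L[ℝ] ℝ where
  toFun v := τ (Fin.append w v)
  map_update_add' v i a b := by simp [append_update_right]
  map_update_smul' v i c a := by simp [append_update_right]
  map_eq_zero_of_eq' v i j hv hij :=
    τ.map_eq_zero_of_eq _ (i := Fin.natAdd k i) (j := Fin.natAdd k j) (by simpa using hv)
      (fun e => hij (Fin.natAdd_injective p k e))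
  cont := by
    refine τ.cont.comp (continuous_pi fun j => ?_)
    refine Fin.addCases (fun j => ?_) (fun j => ?_) j
    · simpa using continuous_const
    · simpa using continuous_apply j

theorem insertFirst_apply {k p : ℕ} (τ : V [⋀^Fin (k + p)]→L[ℝ] ℝ) (w : Fin k → V)
    (v : Fin p → V) : insertFirst τ w v = τ (Fin.append w v) := rfl

/-- `w ↦ τ (w₁, …, w_k, · , …, ·)`, alternating in `w`. -/
def insertAlternating {k p : ℕ} (τ : V [⋀^Fin (k + p)]→L[ℝ] ℝ) :
    V [⋀^Fin k]→ₗ[ℝ] (V [⋀^Fin p]→L[ℝ] ℝ) where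
  toFun w := insertFirst τ w
  map_update_add' w i a b := by
    ext v
    simp [insertFirst_apply, append_update_left]
  map_update_smul' w i c a := by
    ext v
    simp [insertFirst_apply, append_update_left]
  map_eq_zero_of_eq' w i j hw hij := by
    ext v
    exact τ.map_eq_zero_of_eq _ (i := Fin.castAdd p i) (j := Fin.castAdd p j) (by simpa using hw)
      (fun e => hij (Fin.castAdd_injective k p e))

/-- The contraction `X ⌟ τ` of a form `τ` by a multivector `X ∈ Λᵏ V`: the extension by linearity
in `X` of `(X₁ ∧ ⋯ ∧ X_k) ⌟ τ = X_k ⌟ ⋯ ⌟ X₁ ⌟ τ = τ (X₁, …, X_k, ·, …, ·)`. -/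
def contractAt {k p : ℕ} (X : ⋀[ℝ]^k V) (τ : V [⋀^Fin (k + p)]→L[ℝ] ℝ) : V [⋀^Fin p]→L[ℝ] ℝ :=
  exteriorPower.alternatingMapLinearEquiv (insertAlternating τ) X

theorem contractAt_ιMulti {k p : ℕ} (w : Fin k → V) (τ : V [⋀^Fin (k + p)]→L[ℝ] ℝ)
    (v : Fin p → V) :
    contractAt (exteriorPower.ιMulti ℝ k w) τ v = τ (Fin.append w v) := by
  simp [contractAt, insertAlternating, insertFirst_apply]

theorem contractAt_zero {k p : ℕ} (τ : V [⋀^Fin (k + p)]→L[ℝ] ℝ) :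
    contractAt (0 : ⋀[ℝ]^k V) τ = 0 := by
  simp [contractAt]

theorem contractAt_add {k p : ℕ} (X Y : ⋀[ℝ]^k V) (τ : V [⋀^Fin (k + p)]→L[ℝ] ℝ) :
    contractAt (X + Y) τ = contractAt X τ + contractAt Y τ := by
  simp [contractAt]

theorem contractAt_smul {k p : ℕ} (c : ℝ) (X : ⋀[ℝ]^k V) (τ : V [⋀^Fin (k + p)]→L[ℝ] ℝ) :
    contractAt (c • X) τ = c • contractAt X τ := by
  simp [contractAt]

end Algebra

/-! ### Differential forms and multivector fields on a manifold

`M` is a manifold modelled on the finite-dimensional real vector space `E`. -/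

section Manifold

variable (E : Type*) [NormedAddCommGroup E] [NormedSpace ℝ E]
  (M : Type*) [TopologicalSpace M] [ChartedSpace E M]

/-- Families of alternating `p`-forms on the tangent spaces (no smoothness yet). -/
abbrev FormField (p : ℕ) : Type _ :=
  ∀ x : M, TangentSpace 𝓘(ℝ, E) x [⋀^Fin p]→L[ℝ] ℝ

/-- Inhomogeneous form fields: one component in each degree `p : ℕ` (no smoothness yet). -/
def Forms : Type _ := ∀ p : ℕ, FormField E M p

instance : AddCommGroup (Forms E M) := inferInstanceAs (AddCommGroup (∀ p : ℕ, FormField E M p))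

instance : Module ℝ (Forms E M) := inferInstanceAs (Module ℝ (∀ p : ℕ, FormField E M p))

/-- Families of `k`-vectors in the tangent spaces (no smoothness yet). -/
abbrev MultiField (k : ℕ) : Type _ :=
  ∀ x : M, ⋀[ℝ]^k (TangentSpace 𝓘(ℝ, E) x)

variable {E M}

theorem Forms.add_apply (α β : Forms E M) (p : ℕ) : (α + β) p = α p + β p := rfl

theorem Forms.smul_apply (r : ℝ) (α : Forms E M) (p : ℕ) : (r • α) p = r • α p := rfl

/-- The expression of a form field in the chart at `c`: its pull-back by the inverse chart. -/
def chartForm {p : ℕ} (c : M) (α : FormField E M p) (y : E) : E [⋀^Fin p]→L[ℝ] ℝ :=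
  (α ((chartAt E c).symm y)).compContinuousLinearMap
    (mfderiv 𝓘(ℝ, E) 𝓘(ℝ, E) (chartAt E c).symm y)

/-- The expression of a multivector field in the chart at `c`: its push-forward by the chart. -/
def chartMulti {k : ℕ} (c : M) (X : MultiField E M k) (y : E) : ⋀[ℝ]^k E :=
  exteriorPower.map k
    (mfderiv 𝓘(ℝ, E) 𝓘(ℝ, E) (chartAt E c) ((chartAt E c).symm y)).toLinearMap
    (X ((chartAt E c).symm y))

/-- Smoothness of a `p`-form: all its chart expressions are smooth. -/
def IsSmoothForm {p : ℕ} (α : FormField E M p) : Prop :=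
  ∀ c : M, ContDiffOn ℝ (⊤ : ℕ∞) (chartForm c α) (chartAt E c).target

/-- Smoothness of a `k`-vector field: in all charts, all its (linear) coordinates are smooth. -/
def IsSmoothMulti {k : ℕ} (X : MultiField E M k) : Prop :=
  ∀ (c : M) (φ : (⋀[ℝ]^k E) →ₗ[ℝ] ℝ),
    ContDiffOn ℝ (⊤ : ℕ∞) (fun y => φ (chartMulti c X y)) (chartAt E c).target

/-- The exterior derivative of a `p`-form, computed at `x` in the chart at `x`. -/
def extD {p : ℕ} (α : FormField E M p) : FormField E M (p + 1) := fun x =>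
  (extDeriv (chartForm x α) (chartAt E x x)).compContinuousLinearMap
    (mfderiv 𝓘(ℝ, E) 𝓘(ℝ, E) (chartAt E x) x)

/-- The exterior derivative `d` on inhomogeneous forms. -/
def dExt (α : Forms E M) : Forms E M
  | 0 => 0
  | p + 1 => extD (α p)

/-- The contraction `X ⌟ α` of an inhomogeneous form by a `k`-vector field. Components of degree
less than `k` are sent to zero. -/
def contract {k : ℕ} (X : MultiField E M k) (α : Forms E M) : Forms E M :=
  fun p x => contractAt (X x) (α (k + p) x)

theorem chartForm_add {p : ℕ} (c : M) (α β : FormField E M p) :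
    chartForm c (α + β) = chartForm c α + chartForm c β := rfl

theorem chartForm_smul {p : ℕ} (c : M) (r : ℝ) (α : FormField E M p) :
    chartForm c (r • α) = r • chartForm c α := rfl

theorem chartForm_zero {p : ℕ} (c : M) : chartForm c (0 : FormField E M p) = 0 := rfl

theorem IsSmoothForm.differentiableAt {p : ℕ} {α : FormField E M p} (h : IsSmoothForm α) (x : M) :
    DifferentiableAt ℝ (chartForm x α) (chartAt E x x) :=
  ((h x).contDiffAt ((chartAt E x).open_target.mem_nhds
    (mem_chart_target E x))).differentiableAt (by simp)

/-- The space `Ω^j(M)` of smooth differential forms of degree `j : ℤ`; it is zero for `j < 0`. -/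
def Omega (E M : Type*) [NormedAddCommGroup E] [NormedSpace ℝ E] [TopologicalSpace M]
    [ChartedSpace E M] (j : ℤ) : Submodule ℝ (Forms E M) where
  carrier := {α | (∀ p, IsSmoothForm (α p)) ∧ ∀ p : ℕ, (p : ℤ) ≠ j → α p = 0}
  zero_mem' := ⟨fun p c => by
    change ContDiffOn ℝ (⊤ : ℕ∞) (chartForm c (0 : FormField E M p)) _
    rw [chartForm_zero]; exact contDiffOn_const, fun _ _ => rfl⟩
  add_mem' := by
    rintro α β ⟨h1, h2⟩ ⟨h3, h4⟩
    refine ⟨fun p c => ?_, fun p hp => ?_⟩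
    · exact (h1 p c).add (h3 p c)
    · rw [Forms.add_apply, h2 p hp, h4 p hp, add_zero]
  smul_mem' := by
    rintro r α ⟨h1, h2⟩
    refine ⟨fun p c => ?_, fun p hp => ?_⟩
    · exact (h1 p c).const_smul r
    · rw [Forms.smul_apply, h2 p hp, smul_zero]

theorem chartMulti_add {k : ℕ} (c : M) (X Y : MultiField E M k) (y : E) :
    chartMulti c (X + Y) y = chartMulti c X y + chartMulti c Y y :=
  map_add (exteriorPower.map k _) _ _

theorem chartMulti_smul {k : ℕ} (c : M) (r : ℝ) (X : MultiField E M k) (y : E) :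
    chartMulti c (r • X) y = r • chartMulti c X y :=
  map_smul (exteriorPower.map k _) _ _

theorem chartMulti_zero {k : ℕ} (c : M) (y : E) :
    chartMulti c (0 : MultiField E M k) y = 0 :=
  map_zero (exteriorPower.map k _)

/-- The space `Γ(Λᵏ TM)` of smooth `k`-vector fields. -/
def smoothMulti (E M : Type*) [NormedAddCommGroup E] [NormedSpace ℝ E] [TopologicalSpace M]
    [ChartedSpace E M] (k : ℕ) : Submodule ℝ (MultiField E M k) where
  carrier := {X | IsSmoothMulti X}
  zero_mem' := fun c φ => by simpa [chartMulti_zero] using contDiffOn_const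
  add_mem' := fun {X Y} hX hY c φ => by
    simpa [chartMulti_add] using (hX c φ).add (hY c φ)
  smul_mem' := fun r X hX c φ => by
    simpa [chartMulti_smul] using (hX c φ).const_smul r

theorem extD_add {p : ℕ} {α β : FormField E M p} (hα : IsSmoothForm α) (hβ : IsSmoothForm β) :
    extD (α + β) = extD α + extD β := by
  funext x
  simp only [extD, chartForm_add, Pi.add_apply,
    extDeriv_add (hα.differentiableAt x) (hβ.differentiableAt x)]
  rfl

theorem extD_smul {p : ℕ} (r : ℝ) (α : FormField E M p) : extD (r • α) = r • extD α := by
  funext x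
  simp only [extD, chartForm_smul, extDeriv_smul]
  rfl

theorem extD_zero {p : ℕ} : extD (0 : FormField E M p) = 0 := by
  have h := extD_smul (0 : ℝ) (0 : FormField E M p)
  simpa using h

theorem dExt_add {i j : ℤ} {α β : Forms E M} (hα : α ∈ Omega E M i) (hβ : β ∈ Omega E M j) :
    dExt (α + β) = dExt α + dExt β := by
  funext p
  cases p with
  | zero => exact (add_zero _).symm
  | succ p => exact extD_add (hα.1 p) (hβ.1 p)

theorem dExt_smul (r : ℝ) (α : Forms E M) : dExt (r • α) = r • dExt α := by
  funext p
  cases p with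
  | zero => exact (smul_zero r).symm
  | succ p => exact extD_smul r (α p)

theorem dExt_zero : dExt (0 : Forms E M) = 0 := by
  funext p
  cases p with
  | zero => rfl
  | succ p => exact extD_zero

theorem contract_zero {k : ℕ} (α : Forms E M) : contract (0 : MultiField E M k) α = 0 := by
  funext p x
  exact contractAt_zero _

theorem contract_add {k : ℕ} (X Y : MultiField E M k) (α : Forms E M) :
    contract (X + Y) α = contract X α + contract Y α := by
  funext p x
  exact contractAt_add _ _ _

theorem contract_smul {k : ℕ} (r : ℝ) (X : MultiField E M k) (α : Forms E M) :
    contract (r • X) α = r • contract X α := by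
  funext p x
  exact contractAt_smul _ _ _

/-! ### Multisymplectic forms, Hamiltonian forms and the generalized Poisson bracket -/

/-- `(M, ω)` is an `n`-plectic manifold: `ω` is a smooth closed `(n+1)`-form such that
`T_xM → Λⁿ T_x^*M, v ↦ v ⌟ ω` is injective for every `x`. -/
structure IsPlectic (n : ℕ) (ω : Forms E M) : Prop where
  mem : ω ∈ Omega E M (n + 1)
  closed : dExt ω = 0
  nondegenerate : ∀ (x : M) (v : TangentSpace 𝓘(ℝ, E) x),
    (∀ w : Fin n → TangentSpace 𝓘(ℝ, E) x, ω (n + 1) x (Fin.cons v w) = 0) → v = 0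

/-- `X` is a Hamiltonian `k`-vector field of `α`: it is smooth and `dα = - X ⌟ ω`. -/
def IsHamiltonianField (ω : Forms E M) {k : ℕ} (α : Forms E M) (X : MultiField E M k) : Prop :=
  X ∈ smoothMulti E M k ∧ dExt α = -contract X ω

/-- The space `Ω^{n-k}_Ham(M)` of Hamiltonian `(n-k)`-forms. It is zero for `k > n`. -/
def HamForms (n : ℕ) (ω : Forms E M) (k : ℕ) : Submodule ℝ (Forms E M) where
  carrier := {α | α ∈ Omega E M ((n : ℤ) - k) ∧
    ∃ X : MultiField E M k, IsHamiltonianField ω α X}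
  zero_mem' := ⟨zero_mem _, 0, zero_mem _, by rw [dExt_zero, contract_zero, neg_zero]⟩
  add_mem' := by
    rintro α β ⟨hα, X, hX, eX⟩ ⟨hβ, Y, hY, eY⟩
    exact ⟨add_mem hα hβ, X + Y, add_mem hX hY, by
      rw [dExt_add hα hβ, contract_add, eX, eY, neg_add]⟩
  smul_mem' := by
    rintro r α ⟨hα, X, hX, eX⟩
    exact ⟨Submodule.smul_mem _ r hα, r • X, Submodule.smul_mem _ r hX, by
      rw [dExt_smul, contract_smul, eX, smul_neg]⟩

open Classical in
/-- A choice `X_α` of a Hamiltonian `k`-vector field of `α` (zero if there is none). -/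
def hamField (ω : Forms E M) (k : ℕ) (α : Forms E M) : MultiField E M k :=
  if h : ∃ X : MultiField E M k, IsHamiltonianField ω α X then h.choose else 0

/-- The grading `|α| = k + 1` of a Hamiltonian `(n-k)`-form. -/
def hamGrade (k : ℕ) : ℕ := k + 1

/-- The generalized Poisson bracket `{α, β} = (-1)^{|β|} X_β ⌟ X_α ⌟ ω` of
`α ∈ Ω^{n-k}_Ham(M)` and `β ∈ Ω^{n-l}_Ham(M)`. -/
def poisson (ω : Forms E M) (k l : ℕ) (α β : Forms E M) : Forms E M :=
  (-1 : ℝ) ^ hamGrade l • contract (hamField ω l β) (contract (hamField ω k α) ω)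

/-- The closed forms in `Ω^{n-k}_Ham(M)`. -/
def closedHam (n : ℕ) (ω : Forms E M) (k : ℕ) : Submodule ℝ (HamForms n ω k) where
  carrier := {α | dExt (α : Forms E M) = 0}
  zero_mem' := dExt_zero
  add_mem' := by
    rintro ⟨α, hα⟩ ⟨β, hβ⟩ (h1 : dExt α = 0) (h2 : dExt β = 0)
    change dExt (α + β) = 0
    rw [dExt_add hα.1 hβ.1, h1, h2, add_zero]
  smul_mem' := by
    rintro r ⟨α, hα⟩ (h1 : dExt α = 0)
    change dExt (r • α) = 0
    rw [dExt_smul, h1, smul_zero]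

/-- The component of degree `i = |α| - 2 = k - 1` of the graded space
`⨁_{k ≥ 1} Ω^{n-k}_Ham(M) / closed forms`. -/
abbrev HamQuot (n : ℕ) (ω : Forms E M) (i : ℕ) : Type _ :=
  HamForms n ω (i + 1) ⧸ closedHam n ω (i + 1)

end Manifold

/-- A bilinear bracket `L_i × L_j → L_{i+j}` making `⨁ L_i` a graded Lie algebra
(concentrated in degrees `≥ 0`): graded skew-symmetry and the graded Jacobi identity for
homogeneous elements, as equalities in `⨁ L_i`. -/
structure IsGradedLieBracket (L : ℕ → Type*) [∀ i, AddCommGroup (L i)] [∀ i, Module ℝ (L i)]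
    (br : ∀ i j : ℕ, L i →ₗ[ℝ] L j →ₗ[ℝ] L (i + j)) : Prop where
  skew : ∀ (i j : ℕ) (x : L i) (y : L j),
    DirectSum.lof ℝ ℕ L (i + j) (br i j x y) =
      -((-1 : ℝ) ^ (i * j) • DirectSum.lof ℝ ℕ L (j + i) (br j i y x))
  jacobi : ∀ (i j k : ℕ) (x : L i) (y : L j) (z : L k),
    (-1 : ℝ) ^ (i * k) • DirectSum.lof ℝ ℕ L (i + (j + k)) (br i (j + k) x (br j k y z)) +
      (-1 : ℝ) ^ (j * i) • DirectSum.lof ℝ ℕ L (j + (k + i)) (br j (k + i) y (br k i z x)) +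
      (-1 : ℝ) ^ (k * j) • DirectSum.lof ℝ ℕ L (k + (i + j)) (br k (i + j) z (br i j x y)) = 0

end Multisymplectic

end

open Multisymplectic

open scoped Manifold

noncomputable section

namespace Multisymplectic

/-! ### The exterior algebra -/

section ExteriorAlgebra

variable {V V' : Type*} [AddCommGroup V] [Module ℝ V] [AddCommGroup V'] [Module ℝ V']

/-! An inhomogeneous form at a point is a functional on the exterior algebra, and contraction by `X`
is the transpose of left multiplication by `X` (`functional_contractAt`). Graded commutativity of
the exterior algebra therefore makes contractions commute up to the sign `(-1)^(kl)`
(`contract_comm`). Write `i_X` for contraction. In `i_Y i_X ω` the field `X` enters only through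
`i_X ω = -dα` and, after a swap, `Y` only through `i_Y ω = -dβ`. This gives independence of choices
(`poisson_eq`), skew-symmetry, and the vanishing of the bracket when one argument is closed.

The remaining claims rest on one Cartan identity. With `L_X = d i_X - (-1)^k i_X d`, the graded
commutator `L_X i_Y - (-1)^((k+1)l) i_Y L_X` is contraction by a multivector field `[X,Y]`, the
Schouten bracket (`cartan_eq_contract_schouten`). In a vector space (`localCartan`) this is the
Leibniz rule, together with the fact that interior product by a covector is an antiderivation: all
derivatives of the form cancel. On the manifold the commutator needs no choice of chart and forms
separate multivectors, so the local expressions of `[X,Y]` must agree between charts.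

Applied to `ω`, the identity collapses to `d i_X i_Y ω = i_[X,Y] ω` for Hamiltonian `X`, `Y`, since
`ω`, `i_X ω` and `i_Y ω` are closed. So, up to sign, `[X,Y]` is a Hamiltonian field of the bracket
(`poisson_mem`). Applied to `i_Z ω`, it writes `d i_X i_Y i_Z ω` as a signed sum of `i_X d i_Y i_Z
ω` and its two companions (`dExt_contract_contract_contract`). Each companion is a double bracket up
to sign (`poisson_poisson`), which gives the Jacobi identity. The defect is exact, hence zero modulo
closed forms because `d² = 0`. -/

theorem ιMulti_induction {P : ExteriorAlgebra ℝ V → Prop}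
    (ιMulti : ∀ p v, P (ExteriorAlgebra.ιMulti ℝ p v))
    (add : ∀ u v, P u → P v → P (u + v)) (smul : ∀ (r : ℝ) u, P u → P (r • u))
    (u : ExteriorAlgebra ℝ V) : P u := by
  let S : Submodule ℝ (ExteriorAlgebra ℝ V) :=
    { carrier := {u | P u}
      add_mem' := fun {a b} ha hb => add a b ha hb
      zero_mem' := by simpa using smul 0 _ (ιMulti 0 0)
      smul_mem' := fun r a ha => smul r a ha }
  -- A linear map out of the exterior algebra is determined by its values on products of vectors, so
  -- the quotient by `S` is trivial.
  have h : S.mkQ = 0 := by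
    apply ExteriorAlgebra.lhom_ext
    intro p
    ext v
    exact (Submodule.Quotient.mk_eq_zero S).2 (ιMulti p v)
  have hu : S.mkQ u = 0 := by rw [h]; rfl
  exact (Submodule.Quotient.mk_eq_zero S).1 hu

theorem exteriorPower_induction {k : ℕ} {P : ExteriorAlgebra ℝ V → Prop}
    {X : ExteriorAlgebra ℝ V} (hX : X ∈ ⋀[ℝ]^k V)
    (ιMulti : ∀ v : Fin k → V, P (ExteriorAlgebra.ιMulti ℝ k v))
    (add : ∀ u v, P u → P v → P (u + v)) (smul : ∀ (r : ℝ) u, P u → P (r • u)) : P X := by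
  rw [← ExteriorAlgebra.ιMulti_span_fixedDegree] at hX
  induction hX using Submodule.span_induction with
  | mem x h => obtain ⟨v, rfl⟩ := h; exact ιMulti v
  | zero => simpa using smul 0 _ (ιMulti 0)
  | add x y _ _ hx hy => exact add _ _ hx hy
  | smul a x _ hx => exact smul _ _ hx

theorem ι_mul_comm_of_mem {l : ℕ} (v : V) {Y : ExteriorAlgebra ℝ V} (hY : Y ∈ ⋀[ℝ]^l V) :
    ExteriorAlgebra.ι ℝ v * Y = (-1 : ℝ) ^ l • (Y * ExteriorAlgebra.ι ℝ v) := by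
  refine exteriorPower_induction
    (P := fun Y => ExteriorAlgebra.ι ℝ v * Y = (-1 : ℝ) ^ l • (Y * ExteriorAlgebra.ι ℝ v))
    hY (fun w => ?_) (fun a b ha hb => ?_) (fun r a ha => ?_)
  · clear hY
    induction l with
    | zero => simp
    | succ l ih =>
      rw [ExteriorAlgebra.ιMulti_succ_apply, ← mul_assoc,
        eq_neg_of_add_eq_zero_left (ExteriorAlgebra.ι_add_mul_swap v (w 0)), neg_mul, mul_assoc,
        ih, pow_succ, mul_assoc]
      simp
  · rw [mul_add, ha, hb, add_mul, smul_add]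
  · rw [mul_smul_comm, ha, smul_mul_assoc, smul_comm]

/-- Graded commutativity of the exterior algebra. -/
theorem mul_comm_of_mem {k l : ℕ} {X Y : ExteriorAlgebra ℝ V} (hX : X ∈ ⋀[ℝ]^k V)
    (hY : Y ∈ ⋀[ℝ]^l V) : X * Y = (-1 : ℝ) ^ (k * l) • (Y * X) := by
  refine exteriorPower_induction (P := fun X => X * Y = (-1 : ℝ) ^ (k * l) • (Y * X))
    hX (fun w => ?_) (fun a b ha hb => ?_) (fun r a ha => ?_)
  · clear hX
    induction k with
    | zero => simp
    | succ k ih =>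
      rw [ExteriorAlgebra.ιMulti_succ_apply, mul_assoc, ih, mul_smul_comm, ← mul_assoc,
        ι_mul_comm_of_mem _ hY, smul_mul_assoc, smul_smul, mul_assoc, add_mul, one_mul, pow_add]
  · rw [add_mul, ha, hb, mul_add, smul_add]
  · rw [mul_smul_comm, smul_comm, ← ha, smul_mul_assoc]

/-- Interior product of a covector with elements of the exterior algebra. -/
def interior (d : Module.Dual ℝ V) : ExteriorAlgebra ℝ V →ₗ[ℝ] ExteriorAlgebra ℝ V :=
  CliffordAlgebra.contractLeft (Q := 0) d

theorem interior_one (d : Module.Dual ℝ V) : interior d 1 = 0 :=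
  CliffordAlgebra.contractLeft_one (Q := (0 : QuadraticForm ℝ V)) d

theorem interior_ι_mul (d : Module.Dual ℝ V) (v : V) (u : ExteriorAlgebra ℝ V) :
    interior d (ExteriorAlgebra.ι ℝ v * u) = d v • u - ExteriorAlgebra.ι ℝ v * interior d u :=
  CliffordAlgebra.contractLeft_ι_mul (Q := (0 : QuadraticForm ℝ V)) (d := d) v u

/-- Interior product with a covector is an antiderivation. -/
theorem interior_mul_of_mem {k : ℕ} (d : Module.Dual ℝ V) {X : ExteriorAlgebra ℝ V}
    (hX : X ∈ ⋀[ℝ]^k V) (u : ExteriorAlgebra ℝ V) :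
    interior d (X * u) = interior d X * u + (-1 : ℝ) ^ k • (X * interior d u) := by
  refine exteriorPower_induction
    (P := fun X => interior d (X * u) = interior d X * u + (-1 : ℝ) ^ k • (X * interior d u))
    hX (fun w => ?_) (fun a b ha hb => ?_) (fun r a ha => ?_)
  · clear hX
    induction k with
    | zero => simp [interior_one]
    | succ k ih =>
      rw [ExteriorAlgebra.ιMulti_succ_apply, mul_assoc, interior_ι_mul, interior_ι_mul, ih,
        pow_succ, mul_add, sub_mul, mul_smul_comm, smul_mul_assoc, mul_assoc, mul_assoc]
      simp only [mul_neg, mul_one, neg_smul]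
      abel
  · rw [add_mul, map_add, ha, hb, map_add, add_mul, add_mul, smul_add]; abel
  · rw [smul_mul_assoc, map_smul, ha, map_smul, smul_mul_assoc, smul_mul_assoc, smul_add,
      smul_comm r]

/-- The truncated degree at `k = 0` is harmless because interior products kill scalars. -/
theorem interior_mem {k : ℕ} (d : Module.Dual ℝ V) {X : ExteriorAlgebra ℝ V}
    (hX : X ∈ ⋀[ℝ]^k V) : interior d X ∈ ⋀[ℝ]^(k - 1) V := by
  refine exteriorPower_induction (P := fun X => interior d X ∈ ⋀[ℝ]^(k - 1) V)
    hX (fun w => ?_) (fun a b ha hb => ?_) (fun r a ha => ?_)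
  · clear hX
    induction k with
    | zero => simp [interior_one]
    | succ k ih =>
      rw [ExteriorAlgebra.ιMulti_succ_apply, interior_ι_mul]
      refine Submodule.sub_mem _ (Submodule.smul_mem _ _ ?_) ?_
      · exact (exteriorPower.ιMulti ℝ k _).2
      · cases k with
        | zero => simp [interior_one]
        | succ k =>
          have h := SetLike.mul_mem_graded (A := fun i : ℕ => ⋀[ℝ]^i V)
            (show ExteriorAlgebra.ι ℝ (w 0) ∈ ⋀[ℝ]^1 V by
              simp [ExteriorAlgebra.exteriorPower]) (ih fun i => w i.succ)
          have e : 1 + (k + 1 - 1) = k + 1 + 1 - 1 := by omega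
          rw [e] at h
          exact h
  · rw [map_add]; exact Submodule.add_mem _ ha hb
  · rw [map_smul]; exact Submodule.smul_mem _ _ ha

theorem interior_ιMulti {p : ℕ} (d : Module.Dual ℝ V) (v : Fin (p + 1) → V) :
    interior d (ExteriorAlgebra.ιMulti ℝ (p + 1) v) =
      ∑ i, ((-1 : ℝ) ^ i.val * d (v i)) • ExteriorAlgebra.ιMulti ℝ p (i.removeNth v) := by
  induction p with
  | zero =>
    rw [ExteriorAlgebra.ιMulti_succ_apply, interior_ι_mul]
    simp [interior_one]
  | succ p ih =>
    have hv : ∀ i : Fin (p + 1), ExteriorAlgebra.ιMulti ℝ (p + 1) (i.succ.removeNth v) =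
        ExteriorAlgebra.ι ℝ (v 0) *
          ExteriorAlgebra.ιMulti ℝ p (i.removeNth (Matrix.vecTail v)) := by
      intro i
      rw [ExteriorAlgebra.ιMulti_succ_apply]
      congr 2
      funext j
      simp [Matrix.vecTail, Fin.removeNth]
    rw [ExteriorAlgebra.ιMulti_succ_apply, interior_ι_mul, ih, Finset.mul_sum,
      Fin.sum_univ_succ (n := p + 1), sub_eq_add_neg, ← Finset.sum_neg_distrib]
    congr 1
    · rw [Fin.val_zero, pow_zero, one_mul]; rfl
    · refine Finset.sum_congr rfl fun i _ => ?_
      rw [hv, mul_smul_comm, ← neg_smul, Fin.val_succ, pow_succ]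
      congr 1
      simp [Matrix.vecTail]

theorem functional_ext {F G : ExteriorAlgebra ℝ V →ₗ[ℝ] ℝ}
    (h : ∀ p v, F (ExteriorAlgebra.ιMulti ℝ p v) = G (ExteriorAlgebra.ιMulti ℝ p v)) : F = G :=
  ExteriorAlgebra.lhom_ext fun p => AlternatingMap.ext fun v => h p v

theorem multivector_induction {k : ℕ} {P : ⋀[ℝ]^k V → Prop}
    (ιMulti : ∀ v : Fin k → V, P (exteriorPower.ιMulti ℝ k v))
    (add : ∀ X Y, P X → P Y → P (X + Y)) (smul : ∀ (r : ℝ) X, P X → P (r • X))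
    (X : ⋀[ℝ]^k V) : P X := by
  have hX : X ∈ Submodule.span ℝ (Set.range (exteriorPower.ιMulti ℝ k (M := V))) := by
    rw [exteriorPower.ιMulti_span]; trivial
  induction hX using Submodule.span_induction with
  | mem x h => obtain ⟨v, rfl⟩ := h; exact ιMulti v
  | zero => simpa using smul 0 _ (ιMulti 0)
  | add x y _ _ hx hy => exact add _ _ hx hy
  | smul a x _ hx => exact smul _ _ hx

theorem coe_exteriorPower_map {k : ℕ} (f : V →ₗ[ℝ] V') (X : ⋀[ℝ]^k V) :
    (exteriorPower.map k f X : ExteriorAlgebra ℝ V') = ExteriorAlgebra.map f X := by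
  induction X using multivector_induction with
  | ιMulti w => simp [ExteriorAlgebra.map_apply_ιMulti]
  | add X Y hX hY => simp [hX, hY]
  | smul r X hX => simp [hX]

end ExteriorAlgebra

/-! ### Inhomogeneous forms as functionals on the exterior algebra -/

section Functional

variable {V V' : Type*} [AddCommGroup V] [Module ℝ V] [TopologicalSpace V]
  [AddCommGroup V'] [Module ℝ V'] [TopologicalSpace V']

/-- The functional on the exterior algebra defined by an inhomogeneous alternating form. -/
def functional (τ : ∀ p, V [⋀^Fin p]→L[ℝ] ℝ) : ExteriorAlgebra ℝ V →ₗ[ℝ] ℝ :=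
  ExteriorAlgebra.liftAlternating fun p => (τ p).toAlternatingMap

@[simp]
theorem functional_ιMulti (τ : ∀ p, V [⋀^Fin p]→L[ℝ] ℝ) {p : ℕ} (v : Fin p → V) :
    functional τ (ExteriorAlgebra.ιMulti ℝ p v) = τ p v := by
  simp [functional]

theorem functional_injective :
    Function.Injective (functional : (∀ p, V [⋀^Fin p]→L[ℝ] ℝ) → _) := by
  intro τ σ h
  funext p
  ext v
  rw [← functional_ιMulti τ, h, functional_ιMulti]

theorem functional_add (τ σ : ∀ p, V [⋀^Fin p]→L[ℝ] ℝ) :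
    functional (τ + σ) = functional τ + functional σ :=
  functional_ext fun p v => by simp

theorem functional_smul (r : ℝ) (τ : ∀ p, V [⋀^Fin p]→L[ℝ] ℝ) :
    functional (r • τ) = r • functional τ :=
  functional_ext fun p v => by simp

theorem contractAt_add_right {k p : ℕ} (X : ⋀[ℝ]^k V) (τ σ : V [⋀^Fin (k + p)]→L[ℝ] ℝ) :
    contractAt X (τ + σ) = contractAt X τ + contractAt X σ := by
  induction X using multivector_induction with
  | ιMulti w => ext v; simp [contractAt_ιMulti]
  | add X Y hX hY => rw [contractAt_add, hX, hY, contractAt_add, contractAt_add]; abel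
  | smul r X hX => rw [contractAt_smul, hX, contractAt_smul, contractAt_smul, smul_add]

theorem contractAt_smul_right {k p : ℕ} (X : ⋀[ℝ]^k V) (c : ℝ) (τ : V [⋀^Fin (k + p)]→L[ℝ] ℝ) :
    contractAt X (c • τ) = c • contractAt X τ := by
  induction X using multivector_induction with
  | ιMulti w => ext v; simp [contractAt_ιMulti]
  | add X Y hX hY => rw [contractAt_add, hX, hY, contractAt_add, smul_add]
  | smul r X hX => rw [contractAt_smul, hX, contractAt_smul, smul_comm]

/-- Contraction by a fixed multivector as a linear map. -/
def contractₗ {k p : ℕ} (X : ⋀[ℝ]^k V) :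
    (V [⋀^Fin (k + p)]→L[ℝ] ℝ) →ₗ[ℝ] (V [⋀^Fin p]→L[ℝ] ℝ) where
  toFun := contractAt X
  map_add' := contractAt_add_right X
  map_smul' := contractAt_smul_right X

/-- The dictionary on which the file rests: identities between contractions become identities
between products. The order is reversed: contracting by `Y` and then by `X` corresponds to `Y * X`.
-/
theorem functional_contractAt {k : ℕ} (X : ⋀[ℝ]^k V) (τ : ∀ p, V [⋀^Fin p]→L[ℝ] ℝ)
    (u : ExteriorAlgebra ℝ V) :
    functional (fun p => contractAt X (τ (k + p))) u = functional τ (X * u) := by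
  induction u using ιMulti_induction with
  | ιMulti p v =>
    rw [functional_ιMulti]
    induction X using multivector_induction with
    | ιMulti w =>
      rw [exteriorPower.ιMulti_apply_coe, ExteriorAlgebra.ιMulti_mul_ιMulti, functional_ιMulti]
      exact contractAt_ιMulti _ _ _
    | add X Y hX hY =>
      rw [contractAt_add, ContinuousAlternatingMap.add_apply, hX, hY, Submodule.coe_add, add_mul,
        map_add]
    | smul r X hX =>
      rw [contractAt_smul, ContinuousAlternatingMap.smul_apply, hX, Submodule.coe_smul,
        smul_mul_assoc, map_smul]
  | add u v hu hv => rw [map_add, hu, hv, mul_add, map_add]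
  | smul r u hu => rw [map_smul, hu, mul_smul_comm, map_smul]

theorem functional_compContinuousLinearMap (τ : ∀ p, V [⋀^Fin p]→L[ℝ] ℝ) (B : V' →L[ℝ] V)
    (u : ExteriorAlgebra ℝ V') :
    functional (fun p => (τ p).compContinuousLinearMap B) u =
      functional τ (ExteriorAlgebra.map B.toLinearMap u) := by
  induction u using ιMulti_induction with
  | ιMulti p v =>
    rw [functional_ιMulti, ExteriorAlgebra.map_apply_ιMulti, functional_ιMulti]
    rfl
  | add u v hu hv => rw [map_add, hu, hv, map_add, map_add]
  | smul r u hu => rw [map_smul, hu, map_smul, map_smul]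

/-- Naturality of contraction. Only `B ∘ A = id` is needed, since the pulled-back form applies `B`
to the pushed-forward vectors of `X`. -/
theorem contractAt_compContinuousLinearMap {k p : ℕ} (A : V →L[ℝ] V') (B : V' →L[ℝ] V)
    (h : ∀ v, B (A v) = v) (X : ⋀[ℝ]^k V) (τ : V [⋀^Fin (k + p)]→L[ℝ] ℝ) :
    (contractAt X τ).compContinuousLinearMap B =
      contractAt (exteriorPower.map k A.toLinearMap X) (τ.compContinuousLinearMap B) := by
  induction X using multivector_induction with
  | ιMulti w =>
    ext v
    rw [exteriorPower.map_apply_ιMulti, contractAt_ιMulti,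
      ContinuousAlternatingMap.compContinuousLinearMap_apply,
      ContinuousAlternatingMap.compContinuousLinearMap_apply, contractAt_ιMulti]
    congr 1
    funext j
    refine Fin.addCases (fun j => ?_) (fun j => ?_) j <;> simp [h]
  | add X Y hX hY =>
    rw [contractAt_add, map_add, contractAt_add, ← hX, ← hY]; rfl
  | smul r X hX =>
    rw [contractAt_smul, map_smul, contractAt_smul, ← hX]; rfl

end Functional

/-! ### Finite dimension: continuity for free, and duality between forms and multivectors. -/

section FiniteDimensional

variable {E : Type*} [NormedAddCommGroup E] [NormedSpace ℝ E] [FiniteDimensional ℝ E]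

instance finiteDimensional_continuousAlternatingMap {p : ℕ} :
    FiniteDimensional ℝ (E [⋀^Fin p]→L[ℝ] ℝ) :=
  Module.Finite.of_injective
    ({ toFun := fun τ => τ.toMultilinearMap
       map_add' := fun _ _ => rfl
       map_smul' := fun _ _ => rfl } :
      (E [⋀^Fin p]→L[ℝ] ℝ) →ₗ[ℝ] MultilinearMap ℝ (fun _ : Fin p => E) ℝ)
    (fun _ _ h => ContinuousAlternatingMap.ext fun v => congrArg (fun f => f v) h)

/-- In coordinates the map is a polynomial. -/
theorem continuous_alternatingMap {p : ℕ} (f : E [⋀^Fin p]→ₗ[ℝ] ℝ) : Continuous f := by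
  have h : ∀ v, f v = ∑ r : Fin p → Fin (Module.finrank ℝ E),
      (∏ i, (Module.finBasis ℝ E).repr (v i) (r i)) * f fun i => Module.finBasis ℝ E (r i) := by
    intro v
    conv_lhs => rw [show v = fun i => ∑ j, (Module.finBasis ℝ E).repr (v i) j •
      Module.finBasis ℝ E j from funext fun i => ((Module.finBasis ℝ E).sum_repr (v i)).symm]
    rw [← AlternatingMap.coe_multilinearMap, MultilinearMap.map_sum]
    refine Finset.sum_congr rfl fun r _ => ?_
    rw [MultilinearMap.map_smul_univ, smul_eq_mul]
  rw [show (f : (Fin p → E) → ℝ) = _ from funext h]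
  refine continuous_finsetSum _ fun r _ => Continuous.mul (continuous_finsetProd _ fun i _ => ?_)
    continuous_const
  exact (LinearMap.continuous_of_finiteDimensional ((Module.finBasis ℝ E).coord (r i))).comp
    (continuous_apply i)

/-- Multivectors are separated by alternating forms. -/
theorem multivector_ext {k : ℕ} {X Y : ⋀[ℝ]^k E}
    (h : ∀ τ : ∀ p, E [⋀^Fin p]→L[ℝ] ℝ, functional τ X = functional τ Y) : X = Y := by
  rw [← sub_eq_zero, ← Module.forall_dual_apply_eq_zero_iff ℝ]
  intro φ
  -- Every linear functional on `k`-vectors comes from an alternating form; placed in degree `k`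
  -- alone, that form gives an inhomogeneous form to test with.
  let η : E [⋀^Fin k]→L[ℝ] ℝ :=
    { φ.compAlternatingMap (exteriorPower.ιMulti ℝ k) with
      cont := continuous_alternatingMap (φ.compAlternatingMap (exteriorPower.ιMulti ℝ k)) }
  have key : ∀ X : ⋀[ℝ]^k E, functional (Pi.single k η) X = φ X := by
    intro X
    induction X using multivector_induction with
    | ιMulti w =>
      rw [exteriorPower.ιMulti_apply_coe, functional_ιMulti, Pi.single_eq_same]
      rfl
    | add X Y hX hY => rw [Submodule.coe_add, map_add, hX, hY, map_add]
    | smul r X hX => rw [Submodule.coe_smul, map_smul, hX, map_smul]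
  rw [map_sub, ← key, ← key, h, sub_self]

end FiniteDimensional

/-! ### Calculus of forms and multivector fields on a vector space -/

section Local

variable {E : Type*} [NormedAddCommGroup E] [NormedSpace ℝ E]

/-- Componentwise exterior derivative of an inhomogeneous form on a vector space. -/
def localD (T : ∀ p, E → E [⋀^Fin p]→L[ℝ] ℝ) : ∀ p, E → E [⋀^Fin p]→L[ℝ] ℝ
  | 0 => 0
  | p + 1 => extDeriv (T p)

/-- Contraction of an inhomogeneous form on a vector space by a multivector field. -/
def localContract {k : ℕ} (X : E → ⋀[ℝ]^k E) (T : ∀ p, E → E [⋀^Fin p]→L[ℝ] ℝ) :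
    ∀ p, E → E [⋀^Fin p]→L[ℝ] ℝ :=
  fun p y => contractAt (X y) (T (k + p) y)

theorem functional_localContract {k : ℕ} (X : E → ⋀[ℝ]^k E) (T : ∀ p, E → E [⋀^Fin p]→L[ℝ] ℝ)
    (y : E) (u : ExteriorAlgebra ℝ E) :
    functional (fun p => localContract X T p y) u = functional (fun p => T p y) (X y * u) :=
  functional_contractAt (X y) (fun p => T p y) u

theorem localD_congr {T S : ∀ p, E → E [⋀^Fin p]→L[ℝ] ℝ} {y : E}
    (h : ∀ p, T p =ᶠ[nhds y] S p) (p : ℕ) : localD T p y = localD S p y := by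
  cases p with
  | zero => rfl
  | succ p => exact (h p).extDeriv_eq

theorem localContract_congr {k : ℕ} (X : E → ⋀[ℝ]^k E) {T S : ∀ p, E → E [⋀^Fin p]→L[ℝ] ℝ} {y : E}
    (h : ∀ p, T p y = S p y) (p : ℕ) : localContract X T p y = localContract X S p y := by
  rw [localContract, h]; rfl

theorem localContract_eventuallyEq {k : ℕ} (X : E → ⋀[ℝ]^k E)
    {T S : ∀ p, E → E [⋀^Fin p]→L[ℝ] ℝ} {y : E} (h : ∀ p, T p =ᶠ[nhds y] S p) (p : ℕ) :
    localContract X T p =ᶠ[nhds y] localContract X S p := by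
  filter_upwards [h (k + p)] with z hz
  rw [localContract, hz]; rfl

/-- Differentiability of a multivector field on a vector space. -/
def MultiDiffAt {k : ℕ} (X : E → ⋀[ℝ]^k E) (y : E) : Prop :=
  ∀ φ : (⋀[ℝ]^k E) →ₗ[ℝ] ℝ, DifferentiableAt ℝ (fun z => φ (X z)) y

theorem hasFDerivAt_sum_smul_comp {ι F G : Type*} [Fintype ι] [NormedAddCommGroup F]
    [NormedSpace ℝ F] [NormedAddCommGroup G] [NormedSpace ℝ G] {f : ι → E → ℝ} (L : ι → F →L[ℝ] G)
    {T : E → F} {y : E} (hf : ∀ i, DifferentiableAt ℝ (f i) y) (hT : DifferentiableAt ℝ T y) :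
    HasFDerivAt (fun z => ∑ i, f i z • L i (T z))
      (∑ i, (f i y • (L i ∘L fderiv ℝ T y) + (fderiv ℝ (f i) y).smulRight (L i (T y)))) y :=
  HasFDerivAt.fun_sum fun i _ =>
    (hf i).hasFDerivAt.fun_smul ((L i).hasFDerivAt.comp y hT.hasFDerivAt)

variable [FiniteDimensional ℝ E]

/-- The directional derivative of a multivector field on a vector space. -/
def multiDeriv {k : ℕ} (X : E → ⋀[ℝ]^k E) (y v : E) : ⋀[ℝ]^k E :=
  ∑ i, fderiv ℝ (fun z => (Module.finBasis ℝ (⋀[ℝ]^k E)).coord i (X z)) y v •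
    Module.finBasis ℝ (⋀[ℝ]^k E) i

/-- Reduces calculus of multivector fields to scalar coefficient functions multiplying constant
continuous linear maps. -/
theorem localContract_eq_sum {k : ℕ} (X : E → ⋀[ℝ]^k E) (T : ∀ p, E → E [⋀^Fin p]→L[ℝ] ℝ)
    (p : ℕ) : localContract X T p = fun y =>
      ∑ i, (Module.finBasis ℝ (⋀[ℝ]^k E)).coord i (X y) •
        (contractₗ (Module.finBasis ℝ (⋀[ℝ]^k E) i)).toContinuousLinearMap (T (k + p) y) := by
  funext y
  have h := (Module.finBasis ℝ (⋀[ℝ]^k E)).sum_repr (X y)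
  conv_lhs => rw [localContract, ← h]
  simp [contractAt, contractₗ, -Module.Basis.sum_repr]

theorem differentiableAt_localContract {k : ℕ} {X : E → ⋀[ℝ]^k E}
    {T : ∀ p, E → E [⋀^Fin p]→L[ℝ] ℝ} {y : E} (hX : MultiDiffAt X y)
    (hT : ∀ p, DifferentiableAt ℝ (T p) y) (p : ℕ) :
    DifferentiableAt ℝ (localContract X T p) y := by
  rw [localContract_eq_sum]
  exact (hasFDerivAt_sum_smul_comp _ (fun i => hX _) (hT (k + p))).differentiableAt

theorem fderiv_localContract {k : ℕ} {X : E → ⋀[ℝ]^k E} {T : ∀ p, E → E [⋀^Fin p]→L[ℝ] ℝ}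
    {y : E} (hX : MultiDiffAt X y) (hT : ∀ p, DifferentiableAt ℝ (T p) y) (p : ℕ) (v : E) :
    fderiv ℝ (localContract X T p) y v =
      contractAt (multiDeriv X y v) (T (k + p) y) +
        contractAt (X y) (fderiv ℝ (T (k + p)) y v) := by
  have hXy := (Module.finBasis ℝ (⋀[ℝ]^k E)).sum_repr (X y)
  rw [localContract_eq_sum, (hasFDerivAt_sum_smul_comp _ (fun i => hX _) (hT (k + p))).fderiv]
  conv_rhs => rw [← hXy, add_comm]
  simp only [sum_apply, add_apply,
    smul_apply, ContinuousLinearMap.smulRight_apply, Finset.sum_add_distrib,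
    contractAt, multiDeriv, map_sum, map_smul]
  rfl

theorem functional_fderiv_localContract {k : ℕ} {X : E → ⋀[ℝ]^k E}
    {T : ∀ p, E → E [⋀^Fin p]→L[ℝ] ℝ} {y : E} (hX : MultiDiffAt X y)
    (hT : ∀ p, DifferentiableAt ℝ (T p) y) (v : E) (u : ExteriorAlgebra ℝ E) :
    functional (fun p => fderiv ℝ (localContract X T p) y v) u =
      functional (fun p => T p y) (multiDeriv X y v * u) +
        functional (fun p => fderiv ℝ (T p) y v) (X y * u) := by
  rw [← functional_contractAt, ← functional_contractAt, ← LinearMap.add_apply, ← functional_add]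
  congr 2
  funext p
  exact fderiv_localContract hX hT p v

/-- This is `d = ∑ eᵃ ∧ ∂ₐ`, with the wedge by `eᵃ` transposed to an interior product. The
alternating signs of `extDeriv` are those of `interior_ιMulti`. -/
theorem functional_localD (T : ∀ p, E → E [⋀^Fin p]→L[ℝ] ℝ) (y : E) (u : ExteriorAlgebra ℝ E) :
    functional (fun p => localD T p y) u =
      ∑ a, functional (fun p => fderiv ℝ (T p) y (Module.finBasis ℝ E a))
        (interior ((Module.finBasis ℝ E).coord a) u) := by
  induction u using ιMulti_induction with
  | ιMulti p v =>
    rw [functional_ιMulti]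
    cases p with
    | zero => simp [localD, interior_one]
    | succ p =>
      simp only [localD, interior_ιMulti, map_sum, map_smul, functional_ιMulti]
      rw [extDeriv, ContinuousAlternatingMap.alternatizeUncurryFin_apply, Finset.sum_comm]
      refine Finset.sum_congr rfl fun i _ => ?_
      conv_lhs => rw [← (Module.finBasis ℝ E).sum_repr (v i)]
      simp [Finset.mul_sum, mul_assoc, -Module.Basis.sum_repr]
  | add u v hu hv => simp only [map_add, hu, hv, Finset.sum_add_distrib]
  | smul r u hu => simp only [map_smul, hu, Finset.smul_sum]

/-- The Schouten bracket of multivector fields on a vector space, with the sign conventions of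
`localCartan`. -/
def localSchouten {k l : ℕ} (X : E → ⋀[ℝ]^k E) (Y : E → ⋀[ℝ]^l E) (y : E) :
    ExteriorAlgebra ℝ E :=
  -∑ a, ((-1 : ℝ) ^ k • ((multiDeriv Y y (Module.finBasis ℝ E a) : ExteriorAlgebra ℝ E) *
      interior ((Module.finBasis ℝ E).coord a) (X y)) +
    (-1 : ℝ) ^ ((k + 1) * l) • ((multiDeriv X y (Module.finBasis ℝ E a) : ExteriorAlgebra ℝ E) *
      interior ((Module.finBasis ℝ E).coord a) (Y y)))

theorem localSchouten_mem {k l : ℕ} (hk : 1 ≤ k) (hl : 1 ≤ l) (X : E → ⋀[ℝ]^k E)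
    (Y : E → ⋀[ℝ]^l E) (y : E) : localSchouten X Y y ∈ ⋀[ℝ]^(k + l - 1) E := by
  refine Submodule.neg_mem _ (Submodule.sum_mem _ fun a _ => Submodule.add_mem _
    (Submodule.smul_mem _ _ ?_) (Submodule.smul_mem _ _ ?_))
  · have h := SetLike.mul_mem_graded (A := fun i : ℕ => ⋀[ℝ]^i E)
      (multiDeriv Y y (Module.finBasis ℝ E a)).2
      (interior_mem ((Module.finBasis ℝ E).coord a) (X y).2)
    rwa [show l + (k - 1) = k + l - 1 by omega] at h
  · have h := SetLike.mul_mem_graded (A := fun i : ℕ => ⋀[ℝ]^i E)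
      (multiDeriv X y (Module.finBasis ℝ E a)).2
      (interior_mem ((Module.finBasis ℝ E).coord a) (Y y).2)
    rwa [show k + (l - 1) = k + l - 1 by omega] at h

theorem neg_one_pow_mul_self (k : ℕ) : (-1 : ℝ) ^ k * (-1 : ℝ) ^ k = 1 := by
  rw [← mul_pow]; simp

/-- The iterated graded commutator of `d` with two contractions is a contraction. -/
theorem localCartan {k l : ℕ} (hk : 1 ≤ k) {X : E → ⋀[ℝ]^k E} {Y : E → ⋀[ℝ]^l E}
    {T : ∀ p, E → E [⋀^Fin p]→L[ℝ] ℝ} {y : E} (hX : MultiDiffAt X y) (hY : MultiDiffAt Y y)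
    (hT : ∀ p, DifferentiableAt ℝ (T p) y) (u : ExteriorAlgebra ℝ E) :
    functional (fun p => localD (localContract X (localContract Y T)) p y) u
      - (-1 : ℝ) ^ k * functional (fun p => localContract X (localD (localContract Y T)) p y) u
      - (-1 : ℝ) ^ ((k + 1) * l) *
        functional (fun p => localContract Y (localD (localContract X T)) p y) u
      + (-1 : ℝ) ^ (k + (k + 1) * l) *
        functional (fun p => localContract Y (localContract X (localD T)) p y) u =
    functional (fun p => T p y) (localSchouten X Y y * u) := by
  have hYT := differentiableAt_localContract hY hT
  simp only [functional_localContract]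
  simp only [functional_localD, functional_fderiv_localContract hX hYT, functional_fderiv_localContract hX hT,
    functional_fderiv_localContract hY hT, functional_localContract]
  rw [localSchouten, neg_mul, map_neg, Finset.sum_mul, map_sum, Finset.mul_sum, Finset.mul_sum,
    Finset.mul_sum, ← Finset.sum_sub_distrib, ← Finset.sum_sub_distrib, ← Finset.sum_add_distrib,
    ← Finset.sum_neg_distrib]
  refine Finset.sum_congr rfl fun a _ => ?_
  -- For a fixed basis direction the claim is now pure exterior algebra in `X y`, `Y y`, their
  -- derivatives `X'`, `Y'`, and the functionals `F`, `F'` of the form and its derivative.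
  generalize hX' : multiDeriv X y (Module.finBasis ℝ E a) = X'
  generalize hY' : multiDeriv Y y (Module.finBasis ℝ E a) = Y'
  generalize (Module.finBasis ℝ E).coord a = e
  generalize functional (fun p => fderiv ℝ (T p) y (Module.finBasis ℝ E a)) = F'
  generalize functional (fun p => T p y) = F
  have h1 : ∀ w, interior e (X y * w) = interior e (X y) * w + (-1 : ℝ) ^ k • (X y * interior e w) :=
    interior_mul_of_mem e (X y).2
  have h2 : ∀ w, interior e (Y y * w) = interior e (Y y) * w + (-1 : ℝ) ^ l • (Y y * interior e w) :=
    interior_mul_of_mem e (Y y).2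
  have c1 : (Y y : ExteriorAlgebra ℝ E) * X' = (-1 : ℝ) ^ (k * l) • (X' * Y y) := by
    rw [mul_comm k l]; exact mul_comm_of_mem (Y y).2 X'.2
  have c2 : interior e (X y) * (Y y : ExteriorAlgebra ℝ E) =
      (-1 : ℝ) ^ ((k - 1) * l) • ((Y y : ExteriorAlgebra ℝ E) * interior e (X y)) :=
    mul_comm_of_mem (interior_mem e (X y).2) (Y y).2
  -- Removes the truncated degree `k - 1` of the interior product of `X y`.
  obtain ⟨k, rfl⟩ : ∃ i, k = i + 1 := ⟨k - 1, by omega⟩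
  have c3 : ∀ w, (Y y : ExteriorAlgebra ℝ E) * (X' * w) = (-1 : ℝ) ^ ((k + 1) * l) • (X' * (Y y * w)) := by
    intro w
    rw [← mul_assoc, c1, smul_mul_assoc, mul_assoc]
  have c4 : ∀ w, interior e (X y) * ((Y y : ExteriorAlgebra ℝ E) * w) =
      (-1 : ℝ) ^ (k * l) • ((Y y : ExteriorAlgebra ℝ E) * (interior e (X y) * w)) := by
    intro w
    rw [← mul_assoc, c2, smul_mul_assoc, mul_assoc]; rfl
  -- All products are brought to one order of factors. The `F'` terms then cancel, and the `F` terms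
  -- in `X'` and `Y'` give the Schouten bracket; the signs are checked by treating each basic power
  -- of `-1` as `±1`.
  simp only [h1, h2, mul_add, add_mul, map_add, mul_smul_comm, smul_mul_assoc, map_smul, mul_assoc,
    smul_eq_mul, c3, c4, smul_add]
  have e1 := neg_one_pow_mul_self k
  have e2 := neg_one_pow_mul_self l
  have e3 := neg_one_pow_mul_self (k * l)
  simp only [pow_add, one_mul, pow_one, mul_assoc]
  generalize (-1 : ℝ) ^ (k * l) = q at *
  generalize (-1 : ℝ) ^ k = r at *
  generalize (-1 : ℝ) ^ l = s at *
  rcases mul_self_eq_one_iff.1 e1 with rfl | rfl <;> rcases mul_self_eq_one_iff.1 e2 with rfl | rfl <;>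
  rcases mul_self_eq_one_iff.1 e3 with rfl | rfl <;> ring_nf

end Local

/-! ### Smoothness of contractions and of the local Schouten bracket. -/

section LocalSmooth

variable {E : Type*} [NormedAddCommGroup E] [NormedSpace ℝ E]

/-- Smoothness of a multivector field on a subset of a vector space. -/
def MultiSmoothOn {k : ℕ} (X : E → ⋀[ℝ]^k E) (s : Set E) : Prop :=
  ∀ φ : (⋀[ℝ]^k E) →ₗ[ℝ] ℝ, ContDiffOn ℝ (⊤ : ℕ∞) (fun z => φ (X z)) s

theorem MultiSmoothOn.multiDiffAt {k : ℕ} {X : E → ⋀[ℝ]^k E} {s : Set E}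
    (hX : MultiSmoothOn X s) (hs : IsOpen s) {y : E} (hy : y ∈ s) : MultiDiffAt X y :=
  fun φ => ((hX φ).contDiffAt (hs.mem_nhds hy)).differentiableAt (by simp)

variable [FiniteDimensional ℝ E]

theorem contDiffOn_localContract {k : ℕ} {X : E → ⋀[ℝ]^k E} {T : ∀ p, E → E [⋀^Fin p]→L[ℝ] ℝ}
    {s : Set E} (hX : MultiSmoothOn X s) (hT : ∀ p, ContDiffOn ℝ (⊤ : ℕ∞) (T p) s) (p : ℕ) :
    ContDiffOn ℝ (⊤ : ℕ∞) (localContract X T p) s := by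
  rw [localContract_eq_sum]
  exact ContDiffOn.sum fun i _ => (hX _).smul
    ((ContinuousLinearMap.contDiff _).comp_contDiffOn (hT (k + p)))

theorem MultiSmoothOn.multiDeriv {k : ℕ} {X : E → ⋀[ℝ]^k E} {s : Set E}
    (hX : MultiSmoothOn X s) (hs : IsOpen s) (v : E) :
    MultiSmoothOn (fun y => multiDeriv X y v) s := by
  intro φ
  simp only [Multisymplectic.multiDeriv, map_sum, map_smul]
  refine ContDiffOn.sum fun i _ => ContDiffOn.fun_smul ?_ contDiffOn_const
  exact ((hX _).fderiv_of_isOpen (m := (⊤ : ℕ∞)) hs (by simp)).clm_apply contDiffOn_const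

theorem MultiSmoothOn.bilinear {k l : ℕ} {X : E → ⋀[ℝ]^k E} {Y : E → ⋀[ℝ]^l E} {s : Set E}
    (hX : MultiSmoothOn X s) (hY : MultiSmoothOn Y s)
    (B : (⋀[ℝ]^k E) →ₗ[ℝ] (⋀[ℝ]^l E) →ₗ[ℝ] ℝ) :
    ContDiffOn ℝ (⊤ : ℕ∞) (fun y => B (X y) (Y y)) s := by
  have h : ∀ y, B (X y) (Y y) = ∑ i, (Module.finBasis ℝ (⋀[ℝ]^k E)).coord i (X y) •
      B (Module.finBasis ℝ (⋀[ℝ]^k E) i) (Y y) := by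
    intro y
    conv_lhs => rw [← (Module.finBasis ℝ (⋀[ℝ]^k E)).sum_repr (X y)]
    simp [-Module.Basis.sum_repr]
  simp only [h]
  exact ContDiffOn.sum fun i _ => (hX _).smul (hY _)

theorem contDiffOn_localSchouten {k l : ℕ} {X : E → ⋀[ℝ]^k E} {Y : E → ⋀[ℝ]^l E} {s : Set E}
    (hs : IsOpen s) (hX : MultiSmoothOn X s) (hY : MultiSmoothOn Y s)
    (ψ : ExteriorAlgebra ℝ E →ₗ[ℝ] ℝ) :
    ContDiffOn ℝ (⊤ : ℕ∞) (fun y => ψ (localSchouten X Y y)) s := by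
  have key : ∀ {k l : ℕ} {X : E → ⋀[ℝ]^k E} {Y : E → ⋀[ℝ]^l E}, MultiSmoothOn X s →
      MultiSmoothOn Y s → ∀ d : Module.Dual ℝ E, ContDiffOn ℝ (⊤ : ℕ∞)
        (fun y => ψ ((X y : ExteriorAlgebra ℝ E) * interior d (Y y))) s := by
    intro k l X Y hX hY d
    exact hX.bilinear hY ((((LinearMap.mul ℝ (ExteriorAlgebra ℝ E)).compr₂ ψ).compl₁₂
      (⋀[ℝ]^k E).subtype (interior d ∘ₗ (⋀[ℝ]^l E).subtype)))
  simp only [localSchouten, map_neg, map_sum, map_add, map_smul]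
  exact (ContDiffOn.sum fun a _ => ((key (hY.multiDeriv hs _) hX _).const_smul _).add
    ((key (hX.multiDeriv hs _) hY _).const_smul _)).neg

end LocalSmooth

/-! ### Chart expressions -/

section Charts

variable {E : Type*} [NormedAddCommGroup E] [NormedSpace ℝ E]
  {M : Type*} [TopologicalSpace M] [ChartedSpace E M] [IsManifold 𝓘(ℝ, E) (⊤ : ℕ∞) M]

theorem two_le_smooth : minSmoothness ℝ 2 ≤ ((⊤ : ℕ∞) : WithTop ℕ∞) := by
  rw [minSmoothness_of_isRCLikeNormedField]
  exact WithTop.coe_le_coe.2 le_top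

theorem mfderiv_chart_comp_symm (c : M) {y : E} (hy : y ∈ (chartAt E c).target) (v : E) :
    mfderiv 𝓘(ℝ, E) 𝓘(ℝ, E) (chartAt E c) ((chartAt E c).symm y)
      (mfderiv 𝓘(ℝ, E) 𝓘(ℝ, E) (chartAt E c).symm y v) = v := by
  have : IsManifold 𝓘(ℝ, E) 1 M := IsManifold.of_le (n := (⊤ : ℕ∞)) (by simp)
  exact congrArg (fun f => f v)
    ((mdifferentiable_chart (I := 𝓘(ℝ, E)) c).comp_symm_deriv hy)

theorem mfderiv_symm_comp_chart (c : M) {x : M} (hx : x ∈ (chartAt E c).source)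
    (v : TangentSpace 𝓘(ℝ, E) x) :
    mfderiv 𝓘(ℝ, E) 𝓘(ℝ, E) (chartAt E c).symm (chartAt E c x)
      (mfderiv 𝓘(ℝ, E) 𝓘(ℝ, E) (chartAt E c) x v) = v := by
  have : IsManifold 𝓘(ℝ, E) 1 M := IsManifold.of_le (n := (⊤ : ℕ∞)) (by simp)
  exact congrArg (fun f => f v)
    ((mdifferentiable_chart (I := 𝓘(ℝ, E)) c).symm_comp_deriv hx)

theorem mfderiv_symm_comp_chart_symm [FiniteDimensional ℝ E] (c : M) {y : E} (hy : y ∈ (chartAt E c).target)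
    (v : TangentSpace 𝓘(ℝ, E) ((chartAt E c).symm y)) :
    mfderiv 𝓘(ℝ, E) 𝓘(ℝ, E) (chartAt E c).symm y
      (mfderiv 𝓘(ℝ, E) 𝓘(ℝ, E) (chartAt E c) ((chartAt E c).symm y) v) = v := by
  let A : E →ₗ[ℝ] E :=
    (mfderiv 𝓘(ℝ, E) 𝓘(ℝ, E) (chartAt E c) ((chartAt E c).symm y)).toLinearMap
  let B : E →ₗ[ℝ] E := (mfderiv 𝓘(ℝ, E) 𝓘(ℝ, E) (chartAt E c).symm y).toLinearMap
  have h : A * B = 1 := LinearMap.ext fun v => mfderiv_chart_comp_symm c hy v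
  -- In finite dimension a one-sided inverse endomorphism is two-sided.
  exact congrArg (fun f : E →ₗ[ℝ] E => f v) (mul_eq_one_comm.1 h)

theorem contDiffAt_coordChange (c c' : M) {z : E} (hz : z ∈ (chartAt E c').target)
    (hw : (chartAt E c').symm z ∈ (chartAt E c).source) :
    ContDiffAt ℝ (⊤ : ℕ∞) (chartAt E c ∘ (chartAt E c').symm) z := by
  rw [← contMDiffAt_iff_contDiffAt]
  have h1 : ContMDiffAt 𝓘(ℝ, E) 𝓘(ℝ, E) (⊤ : ℕ∞) (chartAt E c) ((chartAt E c').symm z) :=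
    (contMDiffOn_chart (I := 𝓘(ℝ, E))).contMDiffAt ((chartAt E c).open_source.mem_nhds hw)
  have h2 : ContMDiffAt 𝓘(ℝ, E) 𝓘(ℝ, E) (⊤ : ℕ∞) (chartAt E c').symm z :=
    (contMDiffOn_chart_symm (I := 𝓘(ℝ, E))).contMDiffAt ((chartAt E c').open_target.mem_nhds hz)
  exact h1.comp z h2

theorem fderiv_coordChange (c c' : M) {z : E} (hz : z ∈ (chartAt E c').target)
    (hw : (chartAt E c').symm z ∈ (chartAt E c).source) (v : E) :
    fderiv ℝ (chartAt E c ∘ (chartAt E c').symm) z v =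
      mfderiv 𝓘(ℝ, E) 𝓘(ℝ, E) (chartAt E c) ((chartAt E c').symm z)
        (mfderiv 𝓘(ℝ, E) 𝓘(ℝ, E) (chartAt E c').symm z v) := by
  have : IsManifold 𝓘(ℝ, E) 1 M := IsManifold.of_le (n := (⊤ : ℕ∞)) (by simp)
  have h1 := (mdifferentiable_chart (I := 𝓘(ℝ, E)) c).mdifferentiableAt hw
  have h2 := (mdifferentiable_chart (I := 𝓘(ℝ, E)) c').mdifferentiableAt_symm hz
  rw [← mfderiv_eq_fderiv, mfderiv_comp z h1 h2]
  rfl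

theorem chartForm_eq_pullback {p : ℕ} (α : FormField E M p) (c c' : M) {z : E}
    (hz : z ∈ (chartAt E c').target) (hw : (chartAt E c').symm z ∈ (chartAt E c).source) :
    chartForm c' α z =
      (chartForm c α ((chartAt E c ∘ (chartAt E c').symm) z)).compContinuousLinearMap
        (fderiv ℝ (chartAt E c ∘ (chartAt E c').symm) z) := by
  -- All tangent spaces unfold to `E`; with a constant fibre the base point can be rewritten.
  let α' : M → E [⋀^Fin p]→L[ℝ] ℝ := α
  have h : α' ((chartAt E c).symm (chartAt E c ((chartAt E c').symm z))) =
      α' ((chartAt E c').symm z) := by rw [(chartAt E c).left_inv hw]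
  ext v
  change α' ((chartAt E c').symm z) _ =
    α' ((chartAt E c).symm (chartAt E c ((chartAt E c').symm z))) _
  rw [h]
  congr 1
  funext i
  simp only [Function.comp_apply]
  have := fderiv_coordChange c c' hz hw (v i)
  change _ = mfderiv 𝓘(ℝ, E) 𝓘(ℝ, E) (chartAt E c).symm (chartAt E c ((chartAt E c').symm z))
    (fderiv ℝ (chartAt E c ∘ (chartAt E c').symm) z (v i))
  rw [this]
  exact (mfderiv_symm_comp_chart c hw _).symm

theorem chartForm_eventuallyEq_pullback {p : ℕ} (α : FormField E M p) (c c' : M) {z : E}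
    (hz : z ∈ (chartAt E c').target) (hw : (chartAt E c').symm z ∈ (chartAt E c).source) :
    chartForm c' α =ᶠ[nhds z] fun z =>
      (chartForm c α ((chartAt E c ∘ (chartAt E c').symm) z)).compContinuousLinearMap
        (fderiv ℝ (chartAt E c ∘ (chartAt E c').symm) z) := by
  have h : (chartAt E c').target ∩ (chartAt E c').symm ⁻¹' (chartAt E c).source ∈ nhds z :=
    ((chartAt E c').isOpen_inter_preimage_symm (chartAt E c).open_source).mem_nhds ⟨hz, hw⟩
  filter_upwards [h] with z hz
  exact chartForm_eq_pullback α c c' hz.1 hz.2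

/-- A pointwise version of the independence of smoothness from charts, needed for test forms
controlled in one chart only. -/
theorem differentiableAt_chartForm {p : ℕ} {α : FormField E M p} (c c' : M) {z : E}
    (hz : z ∈ (chartAt E c').target) (hw : (chartAt E c').symm z ∈ (chartAt E c).source)
    (hα : DifferentiableAt ℝ (chartForm c α) (chartAt E c ((chartAt E c').symm z))) :
    DifferentiableAt ℝ (chartForm c' α) z := by
  have hf := contDiffAt_coordChange c c' hz hw
  refine DifferentiableAt.congr_of_eventuallyEq ?_ (chartForm_eventuallyEq_pullback α c c' hz hw)
  have h : DifferentiableAt ℝ (chartForm c α ∘ (chartAt E c ∘ (chartAt E c').symm)) z :=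
    DifferentiableAt.comp z hα (hf.differentiableAt (by simp))
  exact h.continuousAlternatingMapCompContinuousLinearMap
    ((hf.fderiv_right (m := 1) (WithTop.coe_le_coe.2 le_top)).differentiableAt (by simp))

/-- The exterior derivative may be computed in any chart. -/
theorem chartForm_extD {p : ℕ} {α : FormField E M p} (c : M) {y : E}
    (hy : y ∈ (chartAt E c).target) (hα : DifferentiableAt ℝ (chartForm c α) y) :
    chartForm c (extD α) y = extDeriv (chartForm c α) y := by
  have hx := (chartAt E c).map_target hy
  have hx' := mem_chart_source E ((chartAt E c).symm y)
  have hz := mem_chart_target E ((chartAt E c).symm y)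
  have hinv := (chartAt E ((chartAt E c).symm y)).left_inv hx'
  have hf : (chartAt E c ∘ (chartAt E ((chartAt E c).symm y)).symm)
      (chartAt E ((chartAt E c).symm y) ((chartAt E c).symm y)) = y := by
    rw [Function.comp_apply, hinv, (chartAt E c).right_inv hy]
  have hw : (chartAt E ((chartAt E c).symm y)).symm
      (chartAt E ((chartAt E c).symm y) ((chartAt E c).symm y)) ∈ (chartAt E c).source := by
    rwa [hinv]
  -- `extD` at a point uses that point's own chart. There the form is the pullback of its expression
  -- in the chart at `c`, and `extDeriv` commutes with pullback.
  have h := (chartForm_eventuallyEq_pullback α c _ hz hw).extDeriv_eq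
  rw [extDeriv_pullback (r := (⊤ : ℕ∞)) (by rwa [hf]) (contDiffAt_coordChange c _ hz hw)
    two_le_smooth, hf] at h
  ext v
  change extDeriv (chartForm ((chartAt E c).symm y) α) _ _ = _
  rw [h, ContinuousAlternatingMap.compContinuousLinearMap_apply]
  congr 1
  funext i
  let g : M → E →L[ℝ] E := fun x => mfderiv 𝓘(ℝ, E) 𝓘(ℝ, E) (chartAt E c) x
  have hg := congrArg g hinv
  let w : E := mfderiv 𝓘(ℝ, E) 𝓘(ℝ, E) (chartAt E c).symm y (v i)
  have h1 : g ((chartAt E c).symm y) w = v i := mfderiv_chart_comp_symm c hy (v i)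
  rw [← hg] at h1
  refine Eq.trans ?_ h1
  refine (fderiv_coordChange c _ hz hw _).trans ?_
  refine congrArg (g _) ?_
  exact mfderiv_symm_comp_chart _ hx' w

end Charts

/-! ### Transport of the local calculus to the manifold. -/

section Global

variable {E : Type*} [NormedAddCommGroup E] [NormedSpace ℝ E]
  {M : Type*} [TopologicalSpace M] [ChartedSpace E M]

/-- The expression of an inhomogeneous form in the chart at `c`. -/
def chartForms (c : M) (τ : Forms E M) (p : ℕ) : E → E [⋀^Fin p]→L[ℝ] ℝ := chartForm c (τ p)

theorem functional_chartForms (c : M) (τ : Forms E M) (y : E) (u : ExteriorAlgebra ℝ E) :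
    functional (fun p => chartForms c τ p y) u =
      functional (fun p => τ p ((chartAt E c).symm y)) (ExteriorAlgebra.map
        (mfderiv 𝓘(ℝ, E) 𝓘(ℝ, E) (chartAt E c).symm y).toLinearMap u) :=
  functional_compContinuousLinearMap (fun p => τ p ((chartAt E c).symm y)) _ u

theorem functional_chartForms_one (c : M) (τ : Forms E M) (y : E) :
    functional (fun p => chartForms c τ p y) 1 =
      functional (fun p => τ p ((chartAt E c).symm y)) 1 :=
  (functional_chartForms c τ y 1).trans (congrArg _ (map_one (ExteriorAlgebra.map _)))

theorem multiSmoothOn_chartMulti {k : ℕ} {X : MultiField E M k} (hX : X ∈ smoothMulti E M k)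
    (c : M) : MultiSmoothOn (chartMulti c X) (chartAt E c).target := hX c

theorem differentiableAt_chartForms {τ : Forms E M} (hτ : ∀ p, IsSmoothForm (τ p)) (c : M) {y : E}
    (hy : y ∈ (chartAt E c).target) (p : ℕ) : DifferentiableAt ℝ (chartForms c τ p) y :=
  ((hτ p c).contDiffAt ((chartAt E c).open_target.mem_nhds hy)).differentiableAt (by simp)

theorem multiDiffAt_chartMulti {k : ℕ} {X : MultiField E M k} (hX : X ∈ smoothMulti E M k)
    (c : M) {y : E} (hy : y ∈ (chartAt E c).target) : MultiDiffAt (chartMulti c X) y :=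
  (multiSmoothOn_chartMulti hX c).multiDiffAt (chartAt E c).open_target hy

variable [IsManifold 𝓘(ℝ, E) (⊤ : ℕ∞) M]

theorem chartForms_dExt {τ : Forms E M} {c : M} {y : E} (hy : y ∈ (chartAt E c).target)
    (hτ : ∀ p, DifferentiableAt ℝ (chartForms c τ p) y) (p : ℕ) :
    chartForms c (dExt τ) p y = localD (chartForms c τ) p y := by
  cases p with
  | zero => rfl
  | succ p => exact chartForm_extD c hy (hτ p)

/-- The exterior derivative squares to zero. -/
theorem dExt_dExt {τ : Forms E M} (hτ : ∀ p, IsSmoothForm (τ p)) : dExt (dExt τ) = 0 := by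
  funext p x
  cases p with
  | zero => rfl
  | succ p =>
    cases p with
    | zero => exact congrFun extD_zero x
    | succ p =>
      have h : chartForm x (extD (τ p)) =ᶠ[nhds (chartAt E x x)] extDeriv (chartForm x (τ p)) := by
        filter_upwards [(chartAt E x).open_target.mem_nhds (mem_chart_target E x)] with z hz
        exact chartForm_extD x hz (differentiableAt_chartForms hτ x hz p)
      change (extDeriv (chartForm x (extD (τ p))) _).compContinuousLinearMap _ = _
      rw [h.extDeriv_eq, extDeriv_extDeriv_apply
        ((hτ p x).contDiffAt ((chartAt E x).open_target.mem_nhds (mem_chart_target E x)))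
        two_le_smooth]
      rfl

variable [FiniteDimensional ℝ E]

theorem forms_ext {α β : Forms E M}
    (h : ∀ c : M, ∀ y ∈ (chartAt E c).target, ∀ p, chartForms c α p y = chartForms c β p y) :
    α = β := by
  funext p x
  obtain ⟨c, y, hy, rfl⟩ : ∃ (c : M) (y : E), y ∈ (chartAt E c).target ∧
      x = (chartAt E c).symm y :=
    ⟨x, chartAt E x x, mem_chart_target E x, ((chartAt E x).left_inv (mem_chart_source E x)).symm⟩
  ext v
  have key : ∀ γ : Forms E M, γ p ((chartAt E c).symm y) v = chartForms c γ p y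
      (fun i => mfderiv 𝓘(ℝ, E) 𝓘(ℝ, E) (chartAt E c) ((chartAt E c).symm y) (v i)) := by
    intro γ
    refine congrArg (γ p ((chartAt E c).symm y)) (funext fun i => ?_)
    exact (mfderiv_symm_comp_chart_symm c hy (v i)).symm
  rw [key, key, h c y hy p]

theorem chartForms_contract {k : ℕ} (X : MultiField E M k) (τ : Forms E M) (c : M) {y : E}
    (hy : y ∈ (chartAt E c).target) (p : ℕ) :
    chartForms c (contract X τ) p y = localContract (chartMulti c X) (chartForms c τ) p y :=
  contractAt_compContinuousLinearMap
    (mfderiv 𝓘(ℝ, E) 𝓘(ℝ, E) (chartAt E c) ((chartAt E c).symm y))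
    (mfderiv 𝓘(ℝ, E) 𝓘(ℝ, E) (chartAt E c).symm y)
    (mfderiv_symm_comp_chart_symm c hy) (X ((chartAt E c).symm y)) _

theorem chartForms_contract_eventuallyEq {k : ℕ} (X : MultiField E M k) (τ : Forms E M) (c : M)
    {y : E} (hy : y ∈ (chartAt E c).target) (p : ℕ) :
    chartForms c (contract X τ) p =ᶠ[nhds y] localContract (chartMulti c X) (chartForms c τ) p := by
  filter_upwards [(chartAt E c).open_target.mem_nhds hy] with z hz
  exact chartForms_contract X τ c hz p

theorem isSmoothForm_contract {k : ℕ} {X : MultiField E M k} (hX : X ∈ smoothMulti E M k)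
    {τ : Forms E M} (hτ : ∀ p, IsSmoothForm (τ p)) (p : ℕ) : IsSmoothForm (contract X τ p) :=
  fun c => (contDiffOn_localContract (multiSmoothOn_chartMulti hX c) (fun p => hτ p c) p).congr
    fun _ hy => chartForms_contract X τ c hy p

theorem differentiableAt_chartForms_contract {k : ℕ} {X : MultiField E M k}
    (hX : X ∈ smoothMulti E M k) {τ : Forms E M} {c : M} {y : E} (hy : y ∈ (chartAt E c).target)
    (hτ : ∀ p, DifferentiableAt ℝ (chartForms c τ p) y) (p : ℕ) :
    DifferentiableAt ℝ (chartForms c (contract X τ) p) y :=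
  (differentiableAt_localContract (multiDiffAt_chartMulti hX c hy) hτ p).congr_of_eventuallyEq
    (chartForms_contract_eventuallyEq X τ c hy p)

/-- The iterated graded commutator of `d` with the contractions by `X` and by `Y`. -/
def cartan {k l : ℕ} (X : MultiField E M k) (Y : MultiField E M l) (τ : Forms E M) : Forms E M :=
  dExt (contract X (contract Y τ)) - (-1 : ℝ) ^ k • contract X (dExt (contract Y τ))
    - (-1 : ℝ) ^ ((k + 1) * l) • contract Y (dExt (contract X τ))
    + (-1 : ℝ) ^ (k + (k + 1) * l) • contract Y (contract X (dExt τ))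

/-- `d` and contraction commute with chart expressions, so `localCartan` applies. Differentiability
at the single point `y` is enough, which lets `chartMulti_schouten` use forms that need not be
smooth on all of `M`. -/
theorem functional_cartan {k l : ℕ} (hk : 1 ≤ k) {X : MultiField E M k} {Y : MultiField E M l}
    (hX : X ∈ smoothMulti E M k) (hY : Y ∈ smoothMulti E M l) {τ : Forms E M} {c : M} {y : E}
    (hy : y ∈ (chartAt E c).target) (hτ : ∀ p, DifferentiableAt ℝ (chartForms c τ p) y)
    (u : ExteriorAlgebra ℝ E) :
    functional (fun p => chartForms c (cartan X Y τ) p y) u =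
      functional (fun p => chartForms c τ p y)
        (localSchouten (chartMulti c X) (chartMulti c Y) y * u) := by
  rw [← localCartan hk (multiDiffAt_chartMulti hX c hy) (multiDiffAt_chartMulti hY c hy) hτ]
  have hXτ := differentiableAt_chartForms_contract hX hy hτ
  have hYτ := differentiableAt_chartForms_contract hY hy hτ
  have hXYτ := differentiableAt_chartForms_contract hX hy hYτ
  have e1 : (fun p => chartForms c (dExt (contract X (contract Y τ))) p y) = fun p =>
      localD (localContract (chartMulti c X) (localContract (chartMulti c Y) (chartForms c τ))) p y :=
    funext fun p => (chartForms_dExt hy hXYτ p).trans (localD_congr (fun p =>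
      (chartForms_contract_eventuallyEq X _ c hy p).trans (localContract_eventuallyEq _
        (chartForms_contract_eventuallyEq Y τ c hy) p)) p)
  have e2 : (fun p => chartForms c (contract X (dExt (contract Y τ))) p y) = fun p =>
      localContract (chartMulti c X) (localD (localContract (chartMulti c Y) (chartForms c τ))) p y :=
    funext fun p => (chartForms_contract X _ c hy p).trans (localContract_congr _ (fun p =>
      (chartForms_dExt hy hYτ p).trans
        (localD_congr (chartForms_contract_eventuallyEq Y τ c hy) p)) p)
  have e3 : (fun p => chartForms c (contract Y (dExt (contract X τ))) p y) = fun p =>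
      localContract (chartMulti c Y) (localD (localContract (chartMulti c X) (chartForms c τ))) p y :=
    funext fun p => (chartForms_contract Y _ c hy p).trans (localContract_congr _ (fun p =>
      (chartForms_dExt hy hXτ p).trans
        (localD_congr (chartForms_contract_eventuallyEq X τ c hy) p)) p)
  have e4 : (fun p => chartForms c (contract Y (contract X (dExt τ))) p y) = fun p =>
      localContract (chartMulti c Y) (localContract (chartMulti c X) (localD (chartForms c τ))) p y :=
    funext fun p => (chartForms_contract Y _ c hy p).trans (localContract_congr _ (fun p =>
      (chartForms_contract X _ c hy p).trans (localContract_congr _ (chartForms_dExt hy hτ) p)) p)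
  rw [← e1, ← e2, ← e3, ← e4]
  simp only [functional_chartForms, ← smul_eq_mul]
  simp only [← LinearMap.smul_apply, ← LinearMap.sub_apply, ← LinearMap.add_apply]
  congr 1
  refine functional_ext fun p v => ?_
  simp only [LinearMap.smul_apply, LinearMap.sub_apply, LinearMap.add_apply, functional_ιMulti]
  rfl

end Global

/-! ### The Schouten bracket -/

section Schouten

variable {E : Type*} [NormedAddCommGroup E] [NormedSpace ℝ E]
  {M : Type*} [TopologicalSpace M] [ChartedSpace E M]

/-- The derivative of the inverse of the chart at `x`, as a map into the tangent space at `x`. -/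
def chartFrame (x : M) : E →L[ℝ] TangentSpace 𝓘(ℝ, E) x :=
  mfderiv 𝓘(ℝ, E) 𝓘(ℝ, E) (chartAt E x).symm (chartAt E x x)

theorem functional_chartForms_self (x : M) (τ : Forms E M) (u : ExteriorAlgebra ℝ E) :
    functional (fun p => chartForms x τ p (chartAt E x x)) u =
      functional (fun p => τ p x) (ExteriorAlgebra.map (chartFrame x).toLinearMap u) := by
  let τ' : ∀ p, M → E [⋀^Fin p]→L[ℝ] ℝ := τ
  let B : E →L[ℝ] E := chartFrame x
  have h := functional_chartForms x τ (chartAt E x x) u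
  change _ = functional (fun p => τ' p ((chartAt E x).symm (chartAt E x x)))
    (ExteriorAlgebra.map B.toLinearMap u) at h
  rw [(chartAt E x).left_inv (mem_chart_source E x)] at h
  exact h

theorem contract_comm {k l : ℕ} (X : MultiField E M k) (Y : MultiField E M l) (τ : Forms E M) :
    contract X (contract Y τ) = (-1 : ℝ) ^ (k * l) • contract Y (contract X τ) := by
  suffices h : ∀ x, (fun p => contract X (contract Y τ) p x) =
      (-1 : ℝ) ^ (k * l) • fun p => contract Y (contract X τ) p x from
    funext fun p => funext fun x => congrFun (h x) p
  intro x
  refine functional_injective (LinearMap.ext fun u => ?_)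
  rw [functional_smul, LinearMap.smul_apply]
  have key : ∀ {k : ℕ} (X : MultiField E M k) (τ : Forms E M) u,
      functional (fun p => contract X τ p x) u = functional (fun p => τ p x) (X x * u) :=
    fun X τ u => functional_contractAt (X x) (fun p => τ p x) u
  rw [key, key, key, key, ← mul_assoc, ← mul_assoc, mul_comm_of_mem (Y x).2 (X x).2,
    smul_mul_assoc, map_smul, mul_comm l k]

variable [FiniteDimensional ℝ E]

/-- The Schouten bracket of multivector fields, computed at `x` in the chart at `x`. -/
def schouten {k l : ℕ} (hk : 1 ≤ k) (hl : 1 ≤ l) (X : MultiField E M k) (Y : MultiField E M l) :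
    MultiField E M (k + l - 1) := fun x =>
  exteriorPower.map (k + l - 1) (chartFrame x).toLinearMap
    ⟨localSchouten (chartMulti x X) (chartMulti x Y) (chartAt E x x),
      localSchouten_mem hk hl _ _ _⟩

variable [IsManifold 𝓘(ℝ, E) (⊤ : ℕ∞) M]

/-- In any chart, the Schouten bracket is given by the local formula. -/
theorem chartMulti_schouten {k l : ℕ} (hk : 1 ≤ k) (hl : 1 ≤ l) {X : MultiField E M k}
    {Y : MultiField E M l} (hX : X ∈ smoothMulti E M k) (hY : Y ∈ smoothMulti E M l) (c : M)
    {y : E} (hy : y ∈ (chartAt E c).target) :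
    (chartMulti c (schouten hk hl X Y) y : ExteriorAlgebra ℝ E) =
      localSchouten (chartMulti c X) (chartMulti c Y) y := by
  suffices h : chartMulti c (schouten hk hl X Y) y =
      ⟨localSchouten (chartMulti c X) (chartMulti c Y) y, localSchouten_mem hk hl _ _ _⟩ from
    congrArg Subtype.val h
  refine multivector_ext fun η => ?_
  -- The test form is constant, equal to `η`, in the chart at `c`.
  let τ : Forms E M := fun p x =>
    (η p).compContinuousLinearMap (mfderiv 𝓘(ℝ, E) 𝓘(ℝ, E) (chartAt E c) x)
  have hτ : ∀ z ∈ (chartAt E c).target, ∀ p, chartForms c τ p z = η p := by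
    intro z hz p
    ext v
    exact congrArg (η p) (funext fun i => mfderiv_chart_comp_symm c hz (v i))
  have hτd : ∀ p, DifferentiableAt ℝ (chartForms c τ p) y := by
    intro p
    refine (differentiableAt_const (η p)).congr_of_eventuallyEq ?_
    filter_upwards [(chartAt E c).open_target.mem_nhds hy] with z hz
    exact hτ z hz p
  -- The degree-zero component of `cartan X Y τ` is a number independent of charts. Computed in the
  -- chart at `x` it pairs `τ` with the globally defined bracket; computed below in the chart at `c`
  -- it pairs `η` with the local formula.
  have key : ∀ x, x = (chartAt E c).symm y →
      functional (fun p => cartan X Y τ p x) 1 =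
        functional (fun p => τ p x) (schouten hk hl X Y x) := by
    intro x hx
    have hxc : x ∈ (chartAt E c).source := hx ▸ (chartAt E c).map_target hy
    have hyx : chartAt E c x = y := by rw [hx, (chartAt E c).right_inv hy]
    have hinv := (chartAt E x).left_inv (mem_chart_source E x)
    have hτx : ∀ p, DifferentiableAt ℝ (chartForms x τ p) (chartAt E x x) := fun p =>
      differentiableAt_chartForm c x (mem_chart_target E x) (by rwa [hinv])
        (by rw [hinv, hyx]; exact hτd p)
    have h := functional_cartan hk hX hY (mem_chart_target E x) hτx 1
    rw [functional_chartForms_self, functional_chartForms_self, map_one, mul_one] at h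
    rw [h, schouten, coe_exteriorPower_map]
  have h := functional_cartan hk hX hY hy hτd 1
  rw [functional_chartForms_one, mul_one, funext (hτ y hy), key _ rfl] at h
  rw [← h, chartMulti, coe_exteriorPower_map]
  exact (functional_compContinuousLinearMap η _ _).symm

theorem schouten_mem {k l : ℕ} (hk : 1 ≤ k) (hl : 1 ≤ l) {X : MultiField E M k}
    {Y : MultiField E M l} (hX : X ∈ smoothMulti E M k) (hY : Y ∈ smoothMulti E M l) :
    schouten hk hl X Y ∈ smoothMulti E M (k + l - 1) := by
  intro c φ
  -- The local formula takes values in the whole exterior algebra, so the coordinate is extended to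
  -- it.
  obtain ⟨ψ, hψ⟩ := LinearMap.exists_extend φ
  refine (contDiffOn_localSchouten (chartAt E c).open_target (multiSmoothOn_chartMulti hX c)
    (multiSmoothOn_chartMulti hY c) ψ).congr fun y hy => ?_
  rw [← hψ, ← chartMulti_schouten hk hl hX hY c hy]
  rfl

theorem cartan_eq_contract_schouten {k l : ℕ} (hk : 1 ≤ k) (hl : 1 ≤ l) {X : MultiField E M k}
    {Y : MultiField E M l} (hX : X ∈ smoothMulti E M k) (hY : Y ∈ smoothMulti E M l)
    {τ : Forms E M} (hτ : ∀ p, IsSmoothForm (τ p)) :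
    cartan X Y τ = contract (schouten hk hl X Y) τ := by
  refine forms_ext fun c y hy p => ?_
  refine congrFun (functional_injective (a₁ := fun p => chartForms c (cartan X Y τ) p y)
    (a₂ := fun p => chartForms c (contract (schouten hk hl X Y) τ) p y) ?_) p
  refine LinearMap.ext fun u => ?_
  rw [functional_cartan hk hX hY hy (differentiableAt_chartForms hτ c hy),
    funext (chartForms_contract (schouten hk hl X Y) τ c hy), functional_localContract,
    chartMulti_schouten hk hl hX hY c hy]

end Schouten

/-! ### The bracket of Hamiltonian forms -/

section Hamiltonian

/-- The degrees `|α|` and `|α| - 2` have the same parity, so regrading changes no sign. -/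
theorem neg_one_pow_hamGrade_mul (a b : ℕ) :
    (-1 : ℝ) ^ (hamGrade (a + 1) * hamGrade (b + 1)) = (-1 : ℝ) ^ (a * b) := by
  rcases neg_one_pow_eq_or ℝ a with ha | ha <;> rcases neg_one_pow_eq_or ℝ b with hb | hb <;>
  simp [hamGrade, pow_mul, pow_add, ha, hb]

variable {E : Type*} [NormedAddCommGroup E] [NormedSpace ℝ E]
  {M : Type*} [TopologicalSpace M] [ChartedSpace E M]

theorem contract_add_right {k : ℕ} (X : MultiField E M k) (α β : Forms E M) :
    contract X (α + β) = contract X α + contract X β := by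
  funext p x
  exact contractAt_add_right _ _ _

theorem contract_smul_right {k : ℕ} (X : MultiField E M k) (r : ℝ) (α : Forms E M) :
    contract X (r • α) = r • contract X α := by
  funext p x
  exact contractAt_smul_right _ _ _

theorem contract_zero_right {k : ℕ} (X : MultiField E M k) :
    contract X (0 : Forms E M) = 0 := by
  simpa using contract_smul_right X 0 0

theorem contract_neg_right {k : ℕ} (X : MultiField E M k) (α : Forms E M) :
    contract X (-α) = -contract X α := by
  simpa using contract_smul_right X (-1) α

theorem IsHamiltonianField.contract_eq {ω α : Forms E M} {k : ℕ} {X : MultiField E M k}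
    (hX : IsHamiltonianField ω α X) : contract X ω = -dExt α := by
  rw [hX.2, neg_neg]

theorem IsHamiltonianField.smul {ω α : Forms E M} {k : ℕ} {X : MultiField E M k}
    (hX : IsHamiltonianField ω α X) (r : ℝ) : IsHamiltonianField ω (r • α) (r • X) :=
  ⟨Submodule.smul_mem _ r hX.1, by rw [dExt_smul, hX.2, contract_smul, smul_neg]⟩

theorem IsHamiltonianField.add {ω α β : Forms E M} {i j : ℤ} (hα : α ∈ Omega E M i)
    (hβ : β ∈ Omega E M j) {k : ℕ} {X Y : MultiField E M k}
    (hX : IsHamiltonianField ω α X) (hY : IsHamiltonianField ω β Y) :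
    IsHamiltonianField ω (α + β) (X + Y) :=
  ⟨Submodule.add_mem _ hX.1 hY.1, by
    rw [dExt_add hα hβ, hX.2, hY.2, contract_add, neg_add]⟩

theorem isHamiltonianField_hamField {n : ℕ} {ω α : Forms E M} {k : ℕ} (hα : α ∈ HamForms n ω k) :
    IsHamiltonianField ω α (hamField ω k α) := by
  have h := hα.2
  rw [hamField, dif_pos h]
  exact h.choose_spec

/-- The bracket may be computed with any Hamiltonian multivector fields. -/
theorem poisson_eq {n : ℕ} {ω α β : Forms E M} {k l : ℕ} (hα : α ∈ HamForms n ω k)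
    (hβ : β ∈ HamForms n ω l) {X : MultiField E M k} {Y : MultiField E M l}
    (hX : IsHamiltonianField ω α X) (hY : IsHamiltonianField ω β Y) :
    poisson ω k l α β = (-1 : ℝ) ^ hamGrade l • contract Y (contract X ω) := by
  -- Each chosen field is exchanged through the differential it represents; the swap brings the
  -- field of `β` next to `ω`.
  rw [poisson, (isHamiltonianField_hamField hα).contract_eq, ← hX.contract_eq, contract_comm,
    (isHamiltonianField_hamField hβ).contract_eq, ← hY.contract_eq, ← contract_comm]

theorem poisson_skew {n : ℕ} {ω α β : Forms E M} {k l : ℕ} (hα : α ∈ HamForms n ω k)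
    (hβ : β ∈ HamForms n ω l) :
    poisson ω k l α β = -((-1 : ℝ) ^ (hamGrade k * hamGrade l) • poisson ω l k β α) := by
  have hX := isHamiltonianField_hamField hα
  have hY := isHamiltonianField_hamField hβ
  rw [poisson_eq hα hβ hX hY, poisson_eq hβ hα hY hX, contract_comm, smul_smul, smul_smul,
    ← neg_smul]
  congr 1
  rcases neg_one_pow_eq_or ℝ k with hk | hk <;> rcases neg_one_pow_eq_or ℝ l with hl | hl <;>
  simp [hamGrade, pow_mul, pow_add, hk, hl]

theorem poisson_add_left {n : ℕ} {ω α α' β : Forms E M} {k l : ℕ} (hα : α ∈ HamForms n ω k)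
    (hα' : α' ∈ HamForms n ω k) (hβ : β ∈ HamForms n ω l) :
    poisson ω k l (α + α') β = poisson ω k l α β + poisson ω k l α' β := by
  have hX := isHamiltonianField_hamField hα
  have hX' := isHamiltonianField_hamField hα'
  have hY := isHamiltonianField_hamField hβ
  rw [poisson_eq (Submodule.add_mem _ hα hα') hβ (hX.add hα.1 hα'.1 hX') hY,
    poisson_eq hα hβ hX hY, poisson_eq hα' hβ hX' hY, contract_add, contract_add_right, smul_add]

theorem poisson_smul_left {n : ℕ} {ω α β : Forms E M} {k l : ℕ} (hα : α ∈ HamForms n ω k)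
    (hβ : β ∈ HamForms n ω l) (r : ℝ) :
    poisson ω k l (r • α) β = r • poisson ω k l α β := by
  have hX := isHamiltonianField_hamField hα
  have hY := isHamiltonianField_hamField hβ
  rw [poisson_eq (Submodule.smul_mem _ r hα) hβ (hX.smul r) hY,
    poisson_eq hα hβ hX hY, contract_smul, contract_smul_right, smul_comm]

theorem poisson_add_right {n : ℕ} {ω α β β' : Forms E M} {k l : ℕ} (hα : α ∈ HamForms n ω k)
    (hβ : β ∈ HamForms n ω l) (hβ' : β' ∈ HamForms n ω l) :
    poisson ω k l α (β + β') = poisson ω k l α β + poisson ω k l α β' := by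
  rw [poisson_skew hα (Submodule.add_mem _ hβ hβ'), poisson_skew hα hβ, poisson_skew hα hβ',
    poisson_add_left hβ hβ' hα, smul_add, neg_add]

theorem poisson_smul_right {n : ℕ} {ω α β : Forms E M} {k l : ℕ} (hα : α ∈ HamForms n ω k)
    (hβ : β ∈ HamForms n ω l) (r : ℝ) :
    poisson ω k l α (r • β) = r • poisson ω k l α β := by
  rw [poisson_skew hα (Submodule.smul_mem _ r hβ), poisson_skew hα hβ,
    poisson_smul_left hβ hα, smul_comm, smul_neg]

/-- The contraction of `ω` by a Hamiltonian field of a closed form is zero, so the bracket vanishes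
outright and not only modulo closed forms. -/
theorem poisson_eq_zero_of_closed_left {n : ℕ} {ω α β : Forms E M} {k l : ℕ}
    (hα : α ∈ HamForms n ω k) (h : dExt α = 0) : poisson ω k l α β = 0 := by
  rw [poisson, (isHamiltonianField_hamField hα).contract_eq, h, neg_zero, contract_zero_right,
    smul_zero]

theorem poisson_eq_zero_of_closed_right {n : ℕ} {ω α β : Forms E M} {k l : ℕ}
    (hα : α ∈ HamForms n ω k) (hβ : β ∈ HamForms n ω l) (h : dExt β = 0) :
    poisson ω k l α β = 0 := by
  rw [poisson_skew hα hβ, poisson_eq_zero_of_closed_left hβ h, smul_zero, neg_zero]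

/-- Moves classes between summands whose indices are equal only propositionally, such as `i + (j +
k)` and `j + (k + i)`. -/
theorem lof_mk_congr {n : ℕ} {ω : Forms E M} {i j : ℕ} (h : i = j) {α : Forms E M}
    (hi : α ∈ HamForms n ω (i + 1)) (hj : α ∈ HamForms n ω (j + 1)) :
    DirectSum.lof ℝ ℕ (HamQuot n ω) i (Submodule.Quotient.mk ⟨α, hi⟩) =
      DirectSum.lof ℝ ℕ (HamQuot n ω) j (Submodule.Quotient.mk ⟨α, hj⟩) := by
  subst h; rfl

variable [IsManifold 𝓘(ℝ, E) (⊤ : ℕ∞) M]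

theorem dExt_contract_eq_zero {n : ℕ} {ω α : Forms E M} {k : ℕ} (hα : α ∈ HamForms n ω k)
    {X : MultiField E M k} (hX : IsHamiltonianField ω α X) : dExt (contract X ω) = 0 := by
  rw [hX.contract_eq, ← neg_one_smul ℝ (dExt α), dExt_smul, dExt_dExt hα.1.1, smul_zero]

variable [FiniteDimensional ℝ E]

/-- Three of the four terms of `cartan X Y ω` contain the differential of a closed form. -/
theorem dExt_contract_contract {n : ℕ} {ω : Forms E M} (hω : IsPlectic n ω) {k l : ℕ} (hk : 1 ≤ k)
    (hl : 1 ≤ l) {X : MultiField E M k} {Y : MultiField E M l} (hX : X ∈ smoothMulti E M k)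
    (hY : Y ∈ smoothMulti E M l) (dX : dExt (contract X ω) = 0) (dY : dExt (contract Y ω) = 0) :
    dExt (contract X (contract Y ω)) = contract (schouten hk hl X Y) ω := by
  rw [← cartan_eq_contract_schouten hk hl hX hY hω.mem.1, cartan, dX, dY, hω.closed]
  simp [contract_zero_right]

/-- The bracket of two Hamiltonian forms is Hamiltonian. -/
theorem poisson_mem {n : ℕ} {ω : Forms E M} (hω : IsPlectic n ω) {k l : ℕ} (hk : 1 ≤ k)
    (hl : 1 ≤ l) {α β : Forms E M} (hα : α ∈ HamForms n ω k) (hβ : β ∈ HamForms n ω l) :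
    poisson ω k l α β ∈ HamForms n ω (k + l - 1) := by
  have hX := isHamiltonianField_hamField hα
  have hY := isHamiltonianField_hamField hβ
  -- The sign of the Hamiltonian field combines the bracket's own sign, the sign of swapping the two
  -- contractions, and the minus in `dα = -X ⌟ ω`.
  refine ⟨Submodule.smul_mem _ _ ⟨isSmoothForm_contract hY.1 (isSmoothForm_contract hX.1 hω.mem.1),
    fun p hp => ?_⟩, -((-1 : ℝ) ^ hamGrade l * (-1 : ℝ) ^ (l * k)) •
      schouten hk hl (hamField ω k α) (hamField ω l β),
    Submodule.smul_mem _ _ (schouten_mem hk hl hX.1 hY.1), ?_⟩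
  -- Only `k + l + p = n + 1` survives, that is `p = n - (k + l - 1)`.
  · have h0 : ω (k + (l + p)) = 0 := hω.mem.2 _ (by push_cast; omega)
    funext x
    have h1 : contract (hamField ω k α) ω (l + p) x = 0 := by
      have := contractAt_smul_right (p := l + p) (hamField ω k α x) 0 0
      rw [contract, h0]
      simpa using this
    have := contractAt_smul_right (p := p) (hamField ω l β x) 0 0
    rw [contract, h1]
    simpa using this
  · rw [poisson, contract_comm, smul_smul, dExt_smul, dExt_contract_contract hω hk hl hX.1 hY.1
      (dExt_contract_eq_zero hα hX) (dExt_contract_eq_zero hβ hY), contract_smul, neg_smul, neg_neg]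

theorem dExt_contract_contract_contract {n : ℕ} {ω : Forms E M} (hω : IsPlectic n ω) {k l m : ℕ}
    (hk : 1 ≤ k) (hl : 1 ≤ l) {X : MultiField E M k} {Y : MultiField E M l} {Z : MultiField E M m}
    (hX : X ∈ smoothMulti E M k) (hY : Y ∈ smoothMulti E M l) (hZ : Z ∈ smoothMulti E M m)
    (dX : dExt (contract X ω) = 0) (dY : dExt (contract Y ω) = 0)
    (dZ : dExt (contract Z ω) = 0) :
    dExt (contract X (contract Y (contract Z ω))) =
      (-1 : ℝ) ^ k • contract X (dExt (contract Y (contract Z ω))) +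
      (-1 : ℝ) ^ ((k + 1) * l) • contract Y (dExt (contract X (contract Z ω))) +
      (-1 : ℝ) ^ ((k + l - 1) * m) • contract Z (dExt (contract X (contract Y ω))) := by
  -- Cartan's identity for the closed form `Z ⌟ ω`. Moving the contraction by `Z` to the outside
  -- leaves `[X,Y] ⌟ ω`, which is `d (X ⌟ Y ⌟ ω)`.
  have h := cartan_eq_contract_schouten hk hl hX hY (isSmoothForm_contract hZ hω.mem.1)
  rw [contract_comm, ← dExt_contract_contract hω hk hl hX hY dX dY, cartan, dZ,
    contract_zero_right, contract_zero_right, smul_zero, add_zero] at h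
  rw [← h]
  abel

/-- The inner bracket enters only through its differential, which replaces the contraction of `ω` by
its Hamiltonian field. -/
theorem poisson_poisson {n : ℕ} {ω : Forms E M} (hω : IsPlectic n ω) {k l m : ℕ}
    (hl : 1 ≤ l) (hm : 1 ≤ m) {α β γ : Forms E M} (hα : α ∈ HamForms n ω k)
    (hβ : β ∈ HamForms n ω l) (hγ : γ ∈ HamForms n ω m) {X : MultiField E M k}
    {Y : MultiField E M l} {Z : MultiField E M m} (hX : IsHamiltonianField ω α X)
    (hY : IsHamiltonianField ω β Y) (hZ : IsHamiltonianField ω γ Z) :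
    poisson ω k (l + m - 1) α (poisson ω l m β γ) =
      (-1 : ℝ) ^ (l + k * (l + m - 1) + m * l) • contract X (dExt (contract Y (contract Z ω))) := by
  have hβγ := poisson_mem hω hl hm hβ hγ
  have hW := isHamiltonianField_hamField hβγ
  rw [poisson_eq hα hβγ hX hW, contract_comm, hW.contract_eq, poisson_eq hβ hγ hY hZ, dExt_smul,
    contract_comm Z Y, dExt_smul, contract_neg_right, contract_smul_right, contract_smul_right,
    smul_neg, ← neg_smul, smul_smul, smul_smul, smul_smul]
  congr 1
  obtain ⟨l, rfl⟩ : ∃ i, l = i + 1 := ⟨l - 1, by omega⟩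
  rw [show l + 1 + m - 1 = l + m by omega]
  rcases neg_one_pow_eq_or ℝ k with hk | hk <;> rcases neg_one_pow_eq_or ℝ l with hl | hl <;>
  rcases neg_one_pow_eq_or ℝ m with hm | hm <;>
  simp [hamGrade, pow_mul, pow_add, hk, hl, hm]

/-- The graded Jacobi identity up to an exact term. -/
theorem poisson_jacobi {n : ℕ} {ω : Forms E M} (hω : IsPlectic n ω) {k l m : ℕ}
    (hk : 1 ≤ k) (hl : 1 ≤ l) (hm : 1 ≤ m) {α β γ : Forms E M} (hα : α ∈ HamForms n ω k)
    (hβ : β ∈ HamForms n ω l) (hγ : γ ∈ HamForms n ω m) {X : MultiField E M k}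
    {Y : MultiField E M l} {Z : MultiField E M m} (hX : IsHamiltonianField ω α X)
    (hY : IsHamiltonianField ω β Y) (hZ : IsHamiltonianField ω γ Z) :
    (-1 : ℝ) ^ (hamGrade k * hamGrade m) • poisson ω k (l + m - 1) α (poisson ω l m β γ) +
      (-1 : ℝ) ^ (hamGrade l * hamGrade k) • poisson ω l (m + k - 1) β (poisson ω m k γ α) +
      (-1 : ℝ) ^ (hamGrade m * hamGrade l) • poisson ω m (k + l - 1) γ (poisson ω k l α β) =
    (-1 : ℝ) ^ (hamGrade l * hamGrade m + hamGrade l * hamGrade k + hamGrade l) •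
      dExt (contract X (contract Y (contract Z ω))) := by
  rw [poisson_poisson hω hl hm hα hβ hγ hX hY hZ, poisson_poisson hω hm hk hβ hγ hα hY hZ hX,
    poisson_poisson hω hk hl hγ hα hβ hZ hX hY,
    dExt_contract_contract_contract hω hk hl hX.1 hY.1 hZ.1 (dExt_contract_eq_zero hα hX)
      (dExt_contract_eq_zero hβ hY) (dExt_contract_eq_zero hγ hZ),
    contract_comm Z X, dExt_smul, contract_smul_right]
  -- Both sides are now combinations of the same three forms; it remains to match three signs, which
  -- depend only on the parities of `k`, `l`, `m`.
  generalize contract X (dExt (contract Y (contract Z ω))) = a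
  generalize contract Y (dExt (contract X (contract Z ω))) = b
  generalize contract Z (dExt (contract X (contract Y ω))) = c
  simp only [smul_add, smul_smul]
  obtain ⟨k, rfl⟩ : ∃ i, k = i + 1 := ⟨k - 1, by omega⟩
  obtain ⟨l, rfl⟩ : ∃ i, l = i + 1 := ⟨l - 1, by omega⟩
  obtain ⟨m, rfl⟩ : ∃ i, m = i + 1 := ⟨m - 1, by omega⟩
  simp only [← add_assoc, Nat.add_sub_cancel]
  congr 1
  · congr 1
    · congr 1
      rcases neg_one_pow_eq_or ℝ k with hk | hk <;> rcases neg_one_pow_eq_or ℝ l with hl | hl <;>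
      rcases neg_one_pow_eq_or ℝ m with hm | hm <;>
      simp [hamGrade, pow_mul, pow_add, hk, hl, hm]
    · congr 1
      rcases neg_one_pow_eq_or ℝ k with hk | hk <;> rcases neg_one_pow_eq_or ℝ l with hl | hl <;>
      rcases neg_one_pow_eq_or ℝ m with hm | hm <;>
      simp [hamGrade, pow_mul, pow_add, hk, hl, hm]
  · congr 1
    rcases neg_one_pow_eq_or ℝ k with hk | hk <;> rcases neg_one_pow_eq_or ℝ l with hl | hl <;>
    rcases neg_one_pow_eq_or ℝ m with hm | hm <;>
    simp [hamGrade, pow_mul, pow_add, hk, hl, hm]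

theorem poisson_succ_mem {n : ℕ} {ω : Forms E M} (hω : IsPlectic n ω) {i j : ℕ}
    {α β : Forms E M} (hα : α ∈ HamForms n ω (i + 1)) (hβ : β ∈ HamForms n ω (j + 1)) :
    poisson ω (i + 1) (j + 1) α β ∈ HamForms n ω (i + j + 1) := by
  have h := poisson_mem hω (Nat.le_add_left 1 i) (Nat.le_add_left 1 j) hα hβ
  rwa [show i + 1 + (j + 1) - 1 = i + j + 1 by omega] at h

/-- The bracket on Hamiltonian forms, as a bilinear map. -/
def hamBracket {n : ℕ} {ω : Forms E M} (hω : IsPlectic n ω) (i j : ℕ) :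
    HamForms n ω (i + 1) →ₗ[ℝ] HamForms n ω (j + 1) →ₗ[ℝ] HamForms n ω (i + j + 1) :=
  LinearMap.mk₂ ℝ
    (fun α β => ⟨poisson ω (i + 1) (j + 1) α β, poisson_succ_mem hω α.2 β.2⟩)
    (fun α α' β => Subtype.ext (poisson_add_left α.2 α'.2 β.2))
    (fun r α β => Subtype.ext (poisson_smul_left α.2 β.2 r))
    (fun α β β' => Subtype.ext (poisson_add_right α.2 β.2 β'.2))
    (fun r α β => Subtype.ext (poisson_smul_right α.2 β.2 r))

/-- The bracket on Hamiltonian forms modulo closed forms. -/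
def quotBracket {n : ℕ} {ω : Forms E M} (hω : IsPlectic n ω) (i j : ℕ) :
    HamQuot n ω i →ₗ[ℝ] HamQuot n ω j →ₗ[ℝ] HamQuot n ω (i + j) :=
  -- The bracket descends in one argument at a time, with `flip` exchanging their roles.
  ((closedHam n ω (j + 1)).liftQ
    ((closedHam n ω (i + 1)).liftQ ((hamBracket hω i j).compr₂ (closedHam n ω (i + j + 1)).mkQ)
      (fun α hα => LinearMap.ext fun β => by
        have h : hamBracket hω i j α β = 0 :=
          Subtype.ext (poisson_eq_zero_of_closed_left α.2 hα)
        simp [h])).flip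
    (fun β hβ => LinearMap.ext fun a => by
      obtain ⟨α, rfl⟩ := Submodule.Quotient.mk_surjective _ a
      have h : hamBracket hω i j α β = 0 :=
        Subtype.ext (poisson_eq_zero_of_closed_right α.2 β.2 hβ)
      exact (congrArg (closedHam n ω (i + j + 1)).mkQ h).trans (map_zero _))).flip

theorem quotBracket_mk {n : ℕ} {ω : Forms E M} (hω : IsPlectic n ω) (i j : ℕ)
    (α : HamForms n ω (i + 1)) (β : HamForms n ω (j + 1)) :
    quotBracket hω i j (Submodule.Quotient.mk α) (Submodule.Quotient.mk β) =
      Submodule.Quotient.mk ⟨poisson ω (i + 1) (j + 1) α β, poisson_succ_mem hω α.2 β.2⟩ := rfl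

theorem isGradedLieBracket_quotBracket {n : ℕ} {ω : Forms E M} (hω : IsPlectic n ω) :
    IsGradedLieBracket (HamQuot n ω) (quotBracket hω) where
  skew i j x y := by
    obtain ⟨α, rfl⟩ := Submodule.Quotient.mk_surjective _ x
    obtain ⟨β, rfl⟩ := Submodule.Quotient.mk_surjective _ y
    rw [quotBracket_mk, quotBracket_mk, lof_mk_congr (add_comm j i) _
      (add_comm j i ▸ poisson_succ_mem hω β.2 α.2), ← map_smul, ← map_neg]
    congr 1
    rw [← Submodule.Quotient.mk_smul, ← Submodule.Quotient.mk_neg]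
    congr 1
    apply Subtype.ext
    refine (poisson_skew α.2 β.2).trans ?_
    rw [neg_one_pow_hamGrade_mul]
    rfl
  jacobi i j k x y z := by
    obtain ⟨α, rfl⟩ := Submodule.Quotient.mk_surjective _ x
    obtain ⟨β, rfl⟩ := Submodule.Quotient.mk_surjective _ y
    obtain ⟨γ, rfl⟩ := Submodule.Quotient.mk_surjective _ z
    have m1 := poisson_succ_mem hω α.2 (poisson_succ_mem hω β.2 γ.2)
    have m2 := poisson_succ_mem hω β.2 (poisson_succ_mem hω γ.2 α.2)
    have m3 := poisson_succ_mem hω γ.2 (poisson_succ_mem hω α.2 β.2)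
    have i2 : j + (k + i) = i + (j + k) := by omega
    have i3 : k + (i + j) = i + (j + k) := by omega
    have hX := isHamiltonianField_hamField α.2
    have hY := isHamiltonianField_hamField β.2
    have hZ := isHamiltonianField_hamField γ.2
    have hJ := poisson_jacobi hω (Nat.le_add_left 1 i) (Nat.le_add_left 1 j) (Nat.le_add_left 1 k)
      α.2 β.2 γ.2 hX hY hZ
    simp only [neg_one_pow_hamGrade_mul] at hJ
    rw [show j + 1 + (k + 1) - 1 = j + k + 1 by omega,
      show k + 1 + (i + 1) - 1 = k + i + 1 by omega,
      show i + 1 + (j + 1) - 1 = i + j + 1 by omega] at hJ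
    simp only [quotBracket_mk]
    rw [lof_mk_congr i2 m2 (i2 ▸ m2), lof_mk_congr i3 m3 (i3 ▸ m3)]
    simp only [← map_smul, ← map_add]
    refine (congrArg _ ?_).trans (map_zero _)
    refine (Submodule.Quotient.mk_eq_zero (closedHam n ω (i + (j + k) + 1))
      (x := (-1 : ℝ) ^ (i * k) • ⟨_, m1⟩ + (-1 : ℝ) ^ (j * i) • ⟨_, i2 ▸ m2⟩ +
        (-1 : ℝ) ^ (k * j) • ⟨_, i3 ▸ m3⟩)).2 ?_
    -- The Jacobi sum is a multiple of an exact form, hence closed, so its class vanishes.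
    refine (congrArg dExt hJ).trans ?_
    rw [dExt_smul, dExt_dExt (isSmoothForm_contract hX.1 (isSmoothForm_contract hY.1
      (isSmoothForm_contract hZ.1 hω.mem.1))), smul_zero]

end Hamiltonian

end Multisymplectic

end

theorem mainTheorem8 {E : Type*} [NormedAddCommGroup E] [NormedSpace ℝ E] [FiniteDimensional ℝ E]
    {M : Type*} [TopologicalSpace M] [T2Space M] [SecondCountableTopology M]
    [ChartedSpace E M] [IsManifold 𝓘(ℝ, E) (⊤ : ℕ∞) M]
    (n : ℕ) (hn : 1 ≤ n) (ω : Forms E M) (hω : IsPlectic n ω) :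
    -- the bracket does not depend on the Hamiltonian multivector fields, and it is Hamiltonian
    (∀ k l : ℕ, 1 ≤ k → 1 ≤ l → ∀ α ∈ HamForms n ω k, ∀ β ∈ HamForms n ω l,
      (∀ (X : MultiField E M k) (Y : MultiField E M l),
        IsHamiltonianField ω α X → IsHamiltonianField ω β Y →
          poisson ω k l α β = (-1 : ℝ) ^ hamGrade l • contract Y (contract X ω)) ∧
      poisson ω k l α β ∈ HamForms n ω (k + l - 1)) ∧
    -- graded skew-symmetry
    (∀ k l : ℕ, 1 ≤ k → 1 ≤ l → ∀ α ∈ HamForms n ω k, ∀ β ∈ HamForms n ω l,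
      poisson ω k l α β = -((-1 : ℝ) ^ (hamGrade k * hamGrade l) • poisson ω l k β α)) ∧
    -- graded Jacobi identity up to an exact term
    (∀ k l m : ℕ, 1 ≤ k → 1 ≤ l → 1 ≤ m →
      ∀ α ∈ HamForms n ω k, ∀ β ∈ HamForms n ω l, ∀ γ ∈ HamForms n ω m,
      ∀ (X : MultiField E M k) (Y : MultiField E M l) (Z : MultiField E M m),
        IsHamiltonianField ω α X → IsHamiltonianField ω β Y → IsHamiltonianField ω γ Z →
          (-1 : ℝ) ^ (hamGrade k * hamGrade m) • poisson ω k (l + m - 1) α (poisson ω l m β γ) +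
            (-1 : ℝ) ^ (hamGrade l * hamGrade k) • poisson ω l (m + k - 1) β (poisson ω m k γ α) +
            (-1 : ℝ) ^ (hamGrade m * hamGrade l) • poisson ω m (k + l - 1) γ (poisson ω k l α β) =
          (-1 : ℝ) ^ (hamGrade l * hamGrade m + hamGrade l * hamGrade k + hamGrade l) •
            dExt (contract X (contract Y (contract Z ω)))) ∧
    -- the bracket descends to a graded Lie algebra structure modulo closed forms
    (∃ br : ∀ i j : ℕ, HamQuot n ω i →ₗ[ℝ] HamQuot n ω j →ₗ[ℝ] HamQuot n ω (i + j),
      (∀ (i j : ℕ) (α : HamForms n ω (i + 1)) (β : HamForms n ω (j + 1)),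
        ∃ h : poisson ω (i + 1) (j + 1) α β ∈ HamForms n ω (i + j + 1),
          br i j (Submodule.Quotient.mk α) (Submodule.Quotient.mk β) =
            Submodule.Quotient.mk ⟨poisson ω (i + 1) (j + 1) α β, h⟩) ∧
      IsGradedLieBracket (HamQuot n ω) br) := by
  refine ⟨fun k l hk hl α hα β hβ => ⟨fun X Y hX hY => poisson_eq hα hβ hX hY,
      poisson_mem hω hk hl hα hβ⟩, fun k l _ _ α hα β hβ => poisson_skew hα hβ,
    fun k l m hk hl hm α hα β hβ γ hγ X Y Z hX hY hZ =>
      poisson_jacobi hω hk hl hm hα hβ hγ hX hY hZ,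
    quotBracket hω, fun i j α β => ⟨poisson_succ_mem hω α.2 β.2, quotBracket_mk hω i j α β⟩,
    isGradedLieBracket_quotBracket hω⟩
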